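/- \textbf{Corollary ($\Delta^0_2$-BQO of $\mathbf 3$ implies ACA).} Over $\mathsf{RCA}_0$, the principle of arithmetical comprehension follows from the assumption that the discrete order $\mathbf 3$ with underlying set $\{0,1,2\}$ is $\Delta^0_2\text{-}\mathsf{BQO}$. Here $[\mathbb N]^\omega$ is the collection of infinite (i.e. unbounded) subsets of $\mathbb N$, and $X^-:=X\setminus\{\min X\}$ for $X\in[\mathbb N]^\omega$. A function $F:[\mathbb N]^\omega\to Q$ into a quasi order $Q$ is bad if there is no $X\in[\mathbb N]^\omega$ with $F(X)\leq_Q F(X^-)$. It is a $\Delta^0_2$-function if the relation $F(X)=q$ is defined by a $\Sigma^0_2$-formula, possibly with number and set parameters. The quasi order $Q$ is $\Delta^0_2\text{-}\mathsf{BQO}$ if there is no bad $\Delta^0_2$-function $F:[\mathbb N]^\omega\to Q$; this is a scheme that ranges over all $\Sigma^0_2$-formulas. Explicitly: let $M$ be any model of $\mathsf{RCA}_0$ (an $L_2$-structure, with possibly nonstandard numbers and an arbitrary nonempty collection of subsets of its number domain as the range of the set quantifiers, that satisfies the basic axioms, $\Sigma^0_1$-induction and $\Delta^0_1$-comprehension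 with parameters). If $\mathbf 3$ is $\Delta^0_2\text{-}\mathsf{BQO}$ in $M$, then for every arithmetical formula $\varphi(n)$ with number and set parameters from $M$ there is a set $X$ in $M$ such that $M\models\forall n\,(n\in X\leftrightarrow\varphi(n))$. (By the completeness theorem, this says precisely that each instance of arithmetical comprehension is provable in $\mathsf{RCA}_0$ extended by the scheme asserting that $\mathbf 3$ is $\Delta^0_2\text{-}\mathsf{BQO}$.) -/

import Mathlib

/-! # The language of second order arithmetic, its structures, and the theory `RCA₀` -/

universe u

namespace SecondOrderArith

/-- Number terms of the language `L₂`; number variables are indexed by natural numbers. -/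
inductive NumTerm : Type
  | var (i : ℕ) : NumTerm
  | zero : NumTerm
  | one : NumTerm
  | add (s t : NumTerm) : NumTerm
  | mul (s t : NumTerm) : NumTerm

/-- The set of number variables that occur in a term. -/
def NumTerm.vars : NumTerm → Set ℕ
  | .var i => {i}
  | .zero => ∅
  | .one => ∅
  | .add s t => s.vars ∪ t.vars
  | .mul s t => s.vars ∪ t.vars

/-- Formulas of the two-sorted language `L₂`. Number variables and set variables are each indexed
by natural numbers; `mem t j` is the atomic formula `t ∈ X_j`. -/
inductive Formula : Type
  | eq (s t : NumTerm) : Formula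
  | lt (s t : NumTerm) : Formula
  | mem (t : NumTerm) (j : ℕ) : Formula
  | neg (φ : Formula) : Formula
  | and (φ ψ : Formula) : Formula
  | or (φ ψ : Formula) : Formula
  | imp (φ ψ : Formula) : Formula
  | all (i : ℕ) (φ : Formula) : Formula
  | ex (i : ℕ) (φ : Formula) : Formula
  | allSet (j : ℕ) (φ : Formula) : Formula
  | exSet (j : ℕ) (φ : Formula) : Formula

namespace Formula

/-- Bounded (`Σ⁰₀`) formulas: built from atomic formulas by propositional connectives and the
bounded number quantifiers `∀ x_i < t` and `∃ x_i < t`, where `x_i` does not occur in `t`.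
Free set variables are allowed. -/
inductive IsBounded : Formula → Prop
  | eq (s t : NumTerm) : IsBounded (.eq s t)
  | lt (s t : NumTerm) : IsBounded (.lt s t)
  | mem (t : NumTerm) (j : ℕ) : IsBounded (.mem t j)
  | neg {φ : Formula} : IsBounded φ → IsBounded (.neg φ)
  | and {φ ψ : Formula} : IsBounded φ → IsBounded ψ → IsBounded (.and φ ψ)
  | or {φ ψ : Formula} : IsBounded φ → IsBounded ψ → IsBounded (.or φ ψ)
  | imp {φ ψ : Formula} : IsBounded φ → IsBounded ψ → IsBounded (.imp φ ψ)
  | ball {i : ℕ} {t : NumTerm} {φ : Formula} : i ∉ t.vars → IsBounded φ →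
      IsBounded (.all i (.imp (.lt (.var i) t) φ))
  | bex {i : ℕ} {t : NumTerm} {φ : Formula} : i ∉ t.vars → IsBounded φ →
      IsBounded (.ex i (.and (.lt (.var i) t) φ))

/-- `Σ⁰₁` formulas `∃ x, θ` with `θ` bounded. -/
def IsSigma1 (φ : Formula) : Prop :=
  ∃ (i : ℕ) (θ : Formula), θ.IsBounded ∧ φ = .ex i θ

/-- `Π⁰₁` formulas `∀ x, θ` with `θ` bounded. -/
def IsPi1 (φ : Formula) : Prop :=
  ∃ (i : ℕ) (θ : Formula), θ.IsBounded ∧ φ = .all i θ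

/-- `Σ⁰₂` formulas `∃ x, ∀ y, θ` with `θ` bounded. -/
def IsSigma2 (φ : Formula) : Prop :=
  ∃ (i : ℕ) (ψ : Formula), ψ.IsPi1 ∧ φ = .ex i ψ

/-- Arithmetical formulas: no set quantifiers (free set variables are allowed). -/
def IsArithmetical : Formula → Prop
  | .eq _ _ => True
  | .lt _ _ => True
  | .mem _ _ => True
  | .neg φ => φ.IsArithmetical
  | .and φ ψ => φ.IsArithmetical ∧ ψ.IsArithmetical
  | .or φ ψ => φ.IsArithmetical ∧ ψ.IsArithmetical
  | .imp φ ψ => φ.IsArithmetical ∧ ψ.IsArithmetical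
  | .all _ φ => φ.IsArithmetical
  | .ex _ φ => φ.IsArithmetical
  | .allSet _ _ => False
  | .exSet _ _ => False

end Formula

end SecondOrderArith

/-- An `L₂`-structure (a general, or Henkin, structure): a domain of numbers with arbitrary
interpretations of `0, 1, +, ·, <`, and a nonempty collection of subsets of that domain, over which
the set quantifiers range. -/
structure L2Structure : Type (u + 1) where
  Num : Type u
  zero : Num
  one : Num
  add : Num → Num → Num
  mul : Num → Num → Num
  lt : Num → Num → Prop
  sets : Set (Set Num)
  sets_nonempty : sets.Nonempty

namespace L2Structure

open SecondOrderArith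

/-- The value of a term under an assignment of number variables. -/
def eval (M : L2Structure.{u}) (v : ℕ → M.Num) : NumTerm → M.Num
  | .var i => v i
  | .zero => M.zero
  | .one => M.one
  | .add s t => M.add (M.eval v s) (M.eval v t)
  | .mul s t => M.mul (M.eval v s) (M.eval v t)

/-- `M.Sat φ v V`: the formula `φ` holds in `M` under the assignments `v` of numbers and `V` of sets
of the structure to the variables. -/
def Sat (M : L2Structure.{u}) : Formula → (ℕ → M.Num) → (ℕ → M.sets) → Prop
  | .eq s t, v, _ => M.eval v s = M.eval v t
  | .lt s t, v, _ => M.lt (M.eval v s) (M.eval v t)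
  | .mem t j, v, V => M.eval v t ∈ (V j : Set M.Num)
  | .neg φ, v, V => ¬ M.Sat φ v V
  | .and φ ψ, v, V => M.Sat φ v V ∧ M.Sat ψ v V
  | .or φ ψ, v, V => M.Sat φ v V ∨ M.Sat ψ v V
  | .imp φ ψ, v, V => M.Sat φ v V → M.Sat ψ v V
  | .all i φ, v, V => ∀ a : M.Num, M.Sat φ (Function.update v i a) V
  | .ex i φ, v, V => ∃ a : M.Num, M.Sat φ (Function.update v i a) V
  | .allSet j φ, v, V => ∀ X : M.sets, M.Sat φ v (Function.update V j X)
  | .exSet j φ, v, V => ∃ X : M.sets, M.Sat φ v (Function.update V j X)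

/-- The basic axioms of second order arithmetic. -/
structure BasicAxioms (M : L2Structure.{u}) : Prop where
  succ_ne_zero : ∀ n, M.add n M.one ≠ M.zero
  succ_inj : ∀ m n, M.add m M.one = M.add n M.one → m = n
  add_zero : ∀ m, M.add m M.zero = m
  add_succ : ∀ m n, M.add m (M.add n M.one) = M.add (M.add m n) M.one
  mul_zero : ∀ m, M.mul m M.zero = M.zero
  mul_succ : ∀ m n, M.mul m (M.add n M.one) = M.add (M.mul m n) m
  not_lt_zero : ∀ m, ¬ M.lt m M.zero
  lt_succ_iff : ∀ m n, M.lt m (M.add n M.one) ↔ M.lt m n ∨ m = n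

/-- The scheme of `Σ⁰₁`-induction, with number and set parameters given by `v` and `V`. -/
def Sigma1Induction (M : L2Structure.{u}) : Prop :=
  ∀ (φ : Formula), φ.IsSigma1 → ∀ (i : ℕ) (v : ℕ → M.Num) (V : ℕ → M.sets),
    M.Sat φ (Function.update v i M.zero) V →
    (∀ n, M.Sat φ (Function.update v i n) V → M.Sat φ (Function.update v i (M.add n M.one)) V) →
    ∀ n, M.Sat φ (Function.update v i n) V

/-- The scheme of `Δ⁰₁`-comprehension, with parameters. -/
def Delta1Comprehension (M : L2Structure.{u}) : Prop :=
  ∀ (φ ψ : Formula), φ.IsSigma1 → ψ.IsPi1 → ∀ (i : ℕ) (v : ℕ → M.Num) (V : ℕ → M.sets),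
    (∀ n, M.Sat φ (Function.update v i n) V ↔ M.Sat ψ (Function.update v i n) V) →
    ∃ X ∈ M.sets, ∀ n, n ∈ X ↔ M.Sat φ (Function.update v i n) V

/-- `M` is a model of `RCA₀`. -/
structure ModelsRCA0 (M : L2Structure.{u}) : Prop where
  basic : M.BasicAxioms
  induction : M.Sigma1Induction
  comprehension : M.Delta1Comprehension

/-- The scheme of arithmetical comprehension, with parameters. -/
def ArithmeticalComprehension (M : L2Structure.{u}) : Prop :=
  ∀ (φ : Formula), φ.IsArithmetical → ∀ (i : ℕ) (v : ℕ → M.Num) (V : ℕ → M.sets),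
    ∃ X ∈ M.sets, ∀ n, n ∈ X ↔ M.Sat φ (Function.update v i n) V

/-- The collection `[ℕ]^ω` in the sense of `M`: the sets of `M` that are unbounded in the numbers
of `M`. -/
def InfSet (M : L2Structure.{u}) : Type u :=
  {X : M.sets // ∀ m, ∃ n ∈ (X : Set M.Num), M.lt m n}

/-- `a` is the minimal element of `X`. -/
def IsMinOf (M : L2Structure.{u}) (X : Set M.Num) (a : M.Num) : Prop :=
  a ∈ X ∧ ∀ b ∈ X, ¬ M.lt b a

/-- The set `X⁻`, obtained from `X` by removing its minimal element. -/
def tail (M : L2Structure.{u}) (X : Set M.Num) : Set M.Num :=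
  {n ∈ X | ¬ M.IsMinOf X n}

/-- `F : [ℕ]^ω → Q` is a `Δ⁰₂`-function of `M`: it takes values in `Q` and the relation `F(X) = q`
is defined by a `Σ⁰₂`-formula, possibly with number and set parameters from `M`. -/
def IsDelta2Fun (M : L2Structure.{u}) (Q : Set M.Num) (F : M.InfSet → M.Num) : Prop :=
  (∀ X, F X ∈ Q) ∧
  ∃ φ : Formula, φ.IsSigma2 ∧ ∃ (i j : ℕ) (v : ℕ → M.Num) (V : ℕ → M.sets),
    ∀ (X : M.InfSet) (q : M.Num),
      F X = q ↔ M.Sat φ (Function.update v i q) (Function.update V j X.1)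

/-- `F` is bad with respect to the relation `le`: there is no `X ∈ [ℕ]^ω` with `F(X) ≤ F(X⁻)`. -/
def IsBad (M : L2Structure.{u}) (le : M.Num → M.Num → Prop) (F : M.InfSet → M.Num) : Prop :=
  ¬ ∃ X Y : M.InfSet, (Y.1 : Set M.Num) = M.tail X.1 ∧ le (F X) (F Y)

/-- In `M`, the quasi order with underlying set `Q` and relation `le` is `Δ⁰₂-BQO`. -/
def IsDelta2BQO (M : L2Structure.{u}) (Q : Set M.Num) (le : M.Num → M.Num → Prop) : Prop :=
  ¬ ∃ F : M.InfSet → M.Num, M.IsDelta2Fun Q F ∧ M.IsBad le F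

/-- The underlying set `{0, 1, 2}` of the order `𝟑`, in the sense of `M`. -/
def three (M : L2Structure.{u}) : Set M.Num :=
  {M.zero, M.one, M.add M.one M.one}

/-- In `M`, the discrete order `𝟑` (in which `p ≤ q` means `p = q`) is `Δ⁰₂-BQO`. -/
def ThreeIsDelta2BQO (M : L2Structure.{u}) : Prop :=
  M.IsDelta2BQO M.three (fun p q => p = q)

end L2Structure

/-! By contraposition, a projection `{n | ∃ a, pair n a ∈ Z}` that is not a set of `M` yields a bad
`Δ⁰₂`-function into `𝟑`. Enumerate the projection in stages. The interval between successive
elements `x < x'` of `X` is true if some number enters during it below which nothing enters after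
`x'`. This property (`Label`) is `Π⁰₁`. If the true intervals of `X`, or the false ones, were
bounded, the projection would be a set, so both kinds occur arbitrarily late
(`Unbounded.exists_label`, `Unbounded.exists_not_label`). Hence there is a first `y ∈ X` whose label
differs from that of the minimum.

The colour of `X` is `1` if `X` has an even number of elements below `y`; otherwise it is `0` or `2`
according to whether `y` is false or true. Deleting the minimum does not affect the other labels. If
`y` is not the second element, it remains the switching point while the parity flips, so the colour
moves between `1` and `{0, 2}`. If `y` is the second element, the colour of `X` records the label of
`y`, whereas the switching point of `X⁻` has the opposite label; again the colours differ
(`Color.ne_of_erase_min`). The colour has a `Σ⁰₂` definition (`color_iff_body`) because parity can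
be read off a code and one number refutes finitely many labels at once.

Conversely, closure under projections lets `sigma1_eq_mem` trade a number quantifier for a set
parameter, so `reducesToBounded` turns every arithmetical formula into a bounded one. Throughout,
bounded definability is a class `D0`, so that instance search produces the formulas needed for
induction and comprehension. -/

/-! ## Renaming of variables -/

namespace SecondOrderArith

/-- Rename the variables of a term. -/
def NumTerm.rename (σ : ℕ → ℕ) : NumTerm → NumTerm
  | .var i => .var (σ i)
  | .zero => .zero
  | .one => .one
  | .add s t => .add (s.rename σ) (t.rename σ)
  | .mul s t => .mul (s.rename σ) (t.rename σ)

theorem NumTerm.vars_rename (σ : ℕ → ℕ) (t : NumTerm) : (t.rename σ).vars = σ '' t.vars := by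
  induction t with
  | var i => simp [rename, vars]
  | zero => simp [rename, vars]
  | one => simp [rename, vars]
  | add s t hs ht => simp [rename, vars, hs, ht, Set.image_union]
  | mul s t hs ht => simp [rename, vars, hs, ht, Set.image_union]

/-- Rename the number variables by `σ` and the set variables by `τ`, bound ones included. -/
def Formula.rename (σ τ : ℕ → ℕ) : Formula → Formula
  | .eq s t => .eq (s.rename σ) (t.rename σ)
  | .lt s t => .lt (s.rename σ) (t.rename σ)
  | .mem t j => .mem (t.rename σ) (τ j)
  | .neg φ => .neg (φ.rename σ τ)
  | .and φ ψ => .and (φ.rename σ τ) (ψ.rename σ τ)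
  | .or φ ψ => .or (φ.rename σ τ) (ψ.rename σ τ)
  | .imp φ ψ => .imp (φ.rename σ τ) (ψ.rename σ τ)
  | .all i φ => .all (σ i) (φ.rename σ τ)
  | .ex i φ => .ex (σ i) (φ.rename σ τ)
  | .allSet j φ => .allSet (τ j) (φ.rename σ τ)
  | .exSet j φ => .exSet (τ j) (φ.rename σ τ)

theorem Formula.IsBounded.rename {σ τ : ℕ → ℕ} (hσ : σ.Injective) {φ : Formula}
    (h : φ.IsBounded) : (φ.rename σ τ).IsBounded := by
  induction h with
  | eq s t => exact .eq _ _
  | lt s t => exact .lt _ _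
  | mem t j => exact .mem _ _
  | neg _ h => exact .neg h
  | and _ _ h h' => exact .and h h'
  | or _ _ h h' => exact .or h h'
  | imp _ _ h h' => exact .imp h h'
  | ball hi _ h => exact .ball (by simpa [NumTerm.vars_rename, hσ.mem_set_image] using hi) h
  | bex hi _ h => exact .bex (by simpa [NumTerm.vars_rename, hσ.mem_set_image] using hi) h

end SecondOrderArith

namespace L2Structure

open SecondOrderArith

variable {M : L2Structure.{u}}

theorem eval_rename (σ : ℕ → ℕ) (v : ℕ → M.Num) (t : NumTerm) :
    M.eval v (t.rename σ) = M.eval (v ∘ σ) t := by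
  induction t with
  | var i => rfl
  | zero => rfl
  | one => rfl
  | add s t hs ht => simp [NumTerm.rename, eval, hs, ht]
  | mul s t hs ht => simp [NumTerm.rename, eval, hs, ht]

/-- Since bound variables are renamed as well, injectivity suffices to exclude capture. -/
theorem sat_rename {σ τ : ℕ → ℕ} (hσ : σ.Injective) (hτ : τ.Injective) (φ : Formula)
    (v : ℕ → M.Num) (V : ℕ → M.sets) :
    M.Sat (φ.rename σ τ) v V ↔ M.Sat φ (v ∘ σ) (V ∘ τ) := by
  induction φ generalizing v V with
  | eq s t => simp [Formula.rename, Sat, eval_rename]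
  | lt s t => simp [Formula.rename, Sat, eval_rename]
  | mem t j => simp [Formula.rename, Sat, eval_rename]
  | neg φ h => simp [Formula.rename, Sat, h]
  | and φ ψ h h' => simp [Formula.rename, Sat, h, h']
  | or φ ψ h h' => simp [Formula.rename, Sat, h, h']
  | imp φ ψ h h' => simp [Formula.rename, Sat, h, h']
  | all i φ h => simp [Formula.rename, Sat, h, Function.update_comp_eq_of_injective _ hσ]
  | ex i φ h => simp [Formula.rename, Sat, h, Function.update_comp_eq_of_injective _ hσ]
  | allSet j φ h => simp [Formula.rename, Sat, h, Function.update_comp_eq_of_injective _ hτ]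
  | exSet j φ h => simp [Formula.rename, Sat, h, Function.update_comp_eq_of_injective _ hτ]

/-! ## Bounded definability with parameters -/

instance : Zero M.Num := ⟨M.zero⟩
instance : One M.Num := ⟨M.one⟩
instance : Add M.Num := ⟨M.add⟩
instance : Mul M.Num := ⟨M.mul⟩
instance : LT M.Num := ⟨M.lt⟩

/-- A context: a type of tuples consisting of one set and a fixed number of numbers. -/
class Ctx (M : outParam L2Structure.{u}) (Γ : Type u) where
  len : ℕ
  val : Γ → ℕ → M.Num
  set : Γ → M.sets

/-- Contexts start from one set and grow by one number at a time, so the type of a nested tuple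
determines the variable that holds each component. -/
instance : Ctx M M.sets := ⟨0, fun _ _ => 0, id⟩

instance {Γ : Type u} [Ctx M Γ] : Ctx M (Γ × M.Num) :=
  ⟨Ctx.len Γ + 1, fun x i => if i = Ctx.len Γ then x.2 else Ctx.val x.1 i, fun x => Ctx.set x.1⟩

variable {Γ : Type u} [Ctx M Γ]

/-- The assignment `v` has the numbers of the context at the even places and the parameters `p`
at the odd places. -/
structure NumFits (γ : Γ) (p : ℕ → M.Num) (v : ℕ → M.Num) : Prop where
  args : ∀ i < Ctx.len Γ, v (2 * i) = Ctx.val γ i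
  params : ∀ i, v (2 * i + 1) = p i

/-- The assignment `V` has the set of the context at place `0`, followed by the parameters `S`. -/
structure SetFits (γ : Γ) (S : ℕ → M.sets) (V : ℕ → M.sets) : Prop where
  arg : V 0 = Ctx.set γ
  params : ∀ i, V (i + 1) = S i

/-- The function `f` is given by a term with parameters `p`. -/
def TmWith (p : ℕ → M.Num) (f : Γ → M.Num) : Prop :=
  ∃ t : NumTerm, (∀ i ∈ t.vars, i % 2 = 0 → i < 2 * Ctx.len Γ) ∧ ∀ γ v, NumFits γ p v → M.eval v t = f γ

/-- The function `f` is given by a term with parameters. -/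
class Tm (f : Γ → M.Num) : Prop where
  out : ∃ p, TmWith p f

/-- The relation `P` is defined by a bounded formula with parameters `p` and `S`. -/
def D0With (p : ℕ → M.Num) (S : ℕ → M.sets) (P : Γ → Prop) : Prop :=
  ∃ φ : Formula, φ.IsBounded ∧
    ∀ γ v V, NumFits γ p v → SetFits γ S V → (M.Sat φ v V ↔ P γ)

/-- The relation `P` is defined by a bounded formula with parameters. -/
class D0 (P : Γ → Prop) : Prop where
  out : ∃ p S, D0With p S P

/-- The set valued function `X` is a set variable or a parameter. -/
class SV (X : Γ → M.sets) : Prop where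
  out : (∀ γ, X γ = Ctx.set γ) ∨ ∃ Y, ∀ γ, X γ = Y

/-- Interleaving of two sequences. -/
def interleave {α : Type*} (p q : ℕ → α) (i : ℕ) : α := if i % 2 = 0 then p (i / 2) else q (i / 2)

/-- Renaming of number variables that makes room for the second half of an interleaved sequence
of parameters. -/
def numLeft (i : ℕ) : ℕ := if i % 2 = 0 then i else 2 * i - 1

/-- Renaming of number variables that makes room for the first half of an interleaved sequence
of parameters. -/
def numRight (i : ℕ) : ℕ := if i % 2 = 0 then i else 2 * i + 1

/-! ### Merging two sequences of parameters -/

theorem numLeft_injective : numLeft.Injective := by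
  intro i j h; unfold numLeft at h; split_ifs at h <;> omega

theorem numRight_injective : numRight.Injective := by
  intro i j h; unfold numRight at h; split_ifs at h <;> omega

theorem setLeft_injective : (fun i : ℕ => 2 * i - 1).Injective := by
  intro i j h; simp only at h; omega

theorem setRight_injective : (fun i : ℕ => 2 * i).Injective := by
  intro i j h; simp only at h; omega

/-- `numLeft` moves place `2 * i + 1` to `2 * (2 * i) + 1`, where the interleaved sequence has `p
i`. -/
theorem NumFits.left {γ : Γ} {p q v : ℕ → M.Num} (h : NumFits γ (interleave p q) v) :
    NumFits γ p (v ∘ numLeft) := by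
  refine ⟨fun i hi => ?_, fun i => ?_⟩
  · simpa [numLeft] using h.args i hi
  · have := h.params (2 * i)
    rw [interleave, if_pos (by omega), show 2 * i / 2 = i by omega] at this
    rw [Function.comp, numLeft, if_neg (by omega), ← this]
    congr 1

theorem NumFits.right {γ : Γ} {p q v : ℕ → M.Num} (h : NumFits γ (interleave p q) v) :
    NumFits γ q (v ∘ numRight) := by
  refine ⟨fun i hi => ?_, fun i => ?_⟩
  · simpa [numRight] using h.args i hi
  · have := h.params (2 * i + 1)
    rw [interleave, if_neg (by omega), show (2 * i + 1) / 2 = i by omega] at this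
    rw [Function.comp, numRight, if_neg (by omega), ← this]

/-- Truncated subtraction fixes place `0`, which holds the set of the context, and sends `i + 1` to
`2 * i + 1`. -/
theorem SetFits.left {γ : Γ} {S T V : ℕ → M.sets} (h : SetFits γ (interleave S T) V) :
    SetFits γ S (V ∘ fun i => 2 * i - 1) := by
  refine ⟨h.arg, fun i => ?_⟩
  have := h.params (2 * i)
  rw [interleave, if_pos (by omega), show 2 * i / 2 = i by omega] at this
  rw [← this]; rfl

theorem SetFits.right {γ : Γ} {S T V : ℕ → M.sets} (h : SetFits γ (interleave S T) V) :
    SetFits γ T (V ∘ fun i => 2 * i) := by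
  refine ⟨h.arg, fun i => ?_⟩
  have := h.params (2 * i + 1)
  rw [interleave, if_neg (by omega), show (2 * i + 1) / 2 = i by omega] at this
  rw [← this]; rfl

theorem TmWith.left {p : ℕ → M.Num} (q : ℕ → M.Num) {f : Γ → M.Num} :
    TmWith p f → TmWith (interleave p q) f := by
  rintro ⟨t, ht, h⟩
  refine ⟨t.rename numLeft, ?_, fun γ v hv => by rw [eval_rename]; exact h γ _ hv.left⟩
  rw [NumTerm.vars_rename]
  rintro _ ⟨i, hi, rfl⟩ h2
  unfold numLeft at h2 ⊢
  split_ifs at h2 ⊢ with h3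
  · exact ht i hi h3
  · omega

theorem TmWith.right (p : ℕ → M.Num) {q : ℕ → M.Num} {f : Γ → M.Num} :
    TmWith q f → TmWith (interleave p q) f := by
  rintro ⟨t, ht, h⟩
  refine ⟨t.rename numRight, ?_, fun γ v hv => by rw [eval_rename]; exact h γ _ hv.right⟩
  rw [NumTerm.vars_rename]
  rintro _ ⟨i, hi, rfl⟩ h2
  unfold numRight at h2 ⊢
  split_ifs at h2 ⊢ with h3
  · exact ht i hi h3
  · omega

theorem D0With.left {p : ℕ → M.Num} {S : ℕ → M.sets} (q : ℕ → M.Num) (T : ℕ → M.sets)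
    {P : Γ → Prop} : D0With p S P → D0With (interleave p q) (interleave S T) P := by
  rintro ⟨φ, hφ, h⟩
  refine ⟨φ.rename numLeft fun i => 2 * i - 1, hφ.rename numLeft_injective, fun γ v V hv hV => ?_⟩
  rw [sat_rename numLeft_injective setLeft_injective]
  exact h γ _ _ hv.left hV.left

theorem D0With.right (p : ℕ → M.Num) (S : ℕ → M.sets) {q : ℕ → M.Num} {T : ℕ → M.sets}
    {P : Γ → Prop} : D0With q T P → D0With (interleave p q) (interleave S T) P := by
  rintro ⟨φ, hφ, h⟩
  refine ⟨φ.rename numRight fun i => 2 * i, hφ.rename numRight_injective, fun γ v V hv hV => ?_⟩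
  rw [sat_rename numRight_injective setRight_injective]
  exact h γ _ _ hv.right hV.right

theorem NumFits.fst {γ : Γ} {a : M.Num} {p v : ℕ → M.Num} (h : NumFits (γ, a) p v) :
    NumFits γ p v :=
  ⟨fun i hi => (h.args i (Nat.lt_succ_of_lt hi)).trans (if_neg hi.ne), h.params⟩

theorem NumFits.snd {γ : Γ} {a : M.Num} {p v : ℕ → M.Num} (h : NumFits (γ, a) p v) :
    v (2 * Ctx.len Γ) = a :=
  (h.args _ (Nat.lt_succ_self _)).trans (if_pos rfl)

theorem NumFits.update {γ : Γ} {p v : ℕ → M.Num} (h : NumFits γ p v) (a : M.Num) :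
    NumFits (γ, a) p (Function.update v (2 * Ctx.len Γ) a) := by
  refine ⟨fun i hi => ?_, fun i => ?_⟩
  · by_cases e : i = Ctx.len Γ
    · simp [Ctx.val, e]
    · rw [Function.update_of_ne (by omega), h.args i (by simp only [Ctx.len] at hi; omega)]
      exact (if_neg e).symm
  · rw [Function.update_of_ne (by omega), h.params]

theorem SetFits.fst {γ : Γ} {a : M.Num} {S V : ℕ → M.sets} :
    SetFits (γ, a) S V ↔ SetFits γ S V :=
  ⟨fun h => ⟨h.arg, h.params⟩, fun h => ⟨h.arg, h.params⟩⟩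

/-- The projection `g` forgets the last few numbers of a tuple. -/
class Proj {Δ : Type u} [Ctx M Δ] (g : Δ → Γ) : Prop where
  len_le : Ctx.len Γ ≤ Ctx.len Δ
  val_eq : ∀ x, ∀ i < Ctx.len Γ, Ctx.val (g x) i = Ctx.val x i
  set_eq : ∀ x, Ctx.set (g x) = Ctx.set x

instance Proj.id : Proj (fun x : Γ => x) := ⟨le_rfl, fun _ _ _ => rfl, fun _ => rfl⟩

/-- With `Tm.snd`, this makes instance search recognise iterated projections such as `x.1.1.2` as
variables. -/
instance Proj.fst {Δ : Type u} [Ctx M Δ] {g : Δ → Γ × M.Num} [hg : Proj g] :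
    Proj (fun x => (g x).1) :=
  ⟨(Nat.le_succ _).trans hg.len_le, fun x i hi =>
    (if_neg hi.ne).symm.trans (hg.val_eq x i (Nat.lt_succ_of_lt hi)), hg.set_eq⟩

theorem Proj.fits {Δ : Type u} [Ctx M Δ] {g : Δ → Γ} (hg : Proj g) {x : Δ} {p v : ℕ → M.Num}
    (h : NumFits x p v) : NumFits (g x) p v :=
  ⟨fun i hi => (h.args i (hi.trans_le hg.len_le)).trans (hg.val_eq x i hi).symm, h.params⟩

/-! ### Closure properties of terms and bounded formulas -/

instance (priority := low) Tm.const (c : M.Num) : Tm (fun _ : Γ => c) :=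
  ⟨fun _ => c, .var 1, by simp [NumTerm.vars], fun _ _ hv => hv.params 0⟩

instance Tm.zero : Tm (fun _ : Γ => (0 : M.Num)) :=
  ⟨fun _ => 0, .zero, by simp [NumTerm.vars], fun _ _ _ => rfl⟩

instance Tm.one : Tm (fun _ : Γ => (1 : M.Num)) :=
  ⟨fun _ => 0, .one, by simp [NumTerm.vars], fun _ _ _ => rfl⟩

instance Tm.snd {Δ : Type u} [Ctx M Δ] {g : Δ → Γ × M.Num} [hg : Proj g] :
    Tm (fun x => (g x).2) := by
  refine ⟨fun _ => 0, .var (2 * Ctx.len Γ), ?_, fun x v hv => (hg.fits hv).snd⟩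
  have := hg.len_le
  simp only [Ctx.len] at this
  simp only [NumTerm.vars, Set.mem_singleton_iff]
  omega

instance (priority := low) Tm.comp {Δ : Type u} [Ctx M Δ] {f : Γ → M.Num} {g : Δ → Γ} [hg : Proj g]
    [hf : Tm f] : Tm (fun x => f (g x)) := by
  obtain ⟨p, t, ht, h⟩ := hf
  refine ⟨p, t, fun i hi h2 => ?_, fun x v hv => h (g x) v (hg.fits hv)⟩
  have := hg.len_le
  have := ht i hi h2
  omega

instance Tm.add {f g : Γ → M.Num} [hf : Tm f] [hg : Tm g] :
    Tm (fun γ => f γ + g γ) := by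
  obtain ⟨p, hf⟩ := hf
  obtain ⟨q, hg⟩ := hg
  obtain ⟨t, ht, h⟩ := hf.left q
  obtain ⟨s, hs, h'⟩ := hg.right p
  refine ⟨_, .add t s, ?_, fun γ v hv => by rw [eval, h γ v hv, h' γ v hv]; rfl⟩
  rintro i (hi | hi)
  exacts [ht i hi, hs i hi]

instance Tm.mul {f g : Γ → M.Num} [hf : Tm f] [hg : Tm g] :
    Tm (fun γ => f γ * g γ) := by
  obtain ⟨p, hf⟩ := hf
  obtain ⟨q, hg⟩ := hg
  obtain ⟨t, ht, h⟩ := hf.left q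
  obtain ⟨s, hs, h'⟩ := hg.right p
  refine ⟨_, .mul t s, ?_, fun γ v hv => by rw [eval, h γ v hv, h' γ v hv]; rfl⟩
  rintro i (hi | hi)
  exacts [ht i hi, hs i hi]

instance (priority := low) SV.const (Y : M.sets) : SV (fun _ : Γ => Y) := ⟨Or.inr ⟨Y, fun _ => rfl⟩⟩

instance SV.proj {g : Γ → M.sets} [hg : Proj g] : SV (fun x => g x) := ⟨Or.inl hg.set_eq⟩

instance (priority := low) SV.comp {Δ : Type u} [Ctx M Δ] {X : Γ → M.sets} {g : Δ → Γ}
    [hg : Proj g] [hX : SV X] : SV (fun x => X (g x)) := by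
  obtain ⟨h | ⟨Y, h⟩⟩ := hX
  exacts [⟨Or.inl fun x => (h _).trans (hg.set_eq x)⟩, ⟨Or.inr ⟨Y, fun x => h _⟩⟩]

theorem D0.fst {P : Γ → Prop} [hP : D0 P] : D0 (fun x : Γ × M.Num => P x.1) := by
  obtain ⟨p, S, φ, hφ, h⟩ := hP
  exact ⟨p, S, φ, hφ, fun x v V hv hV => h x.1 v V hv.fst (SetFits.fst.1 hV)⟩

theorem exists_set (M : L2Structure.{u}) : Nonempty M.sets := M.sets_nonempty.to_subtype

instance D0.mem {f : Γ → M.Num} {X : Γ → M.sets} [hf : Tm f] [hX : SV X] :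
    D0 (fun γ => f γ ∈ (X γ : Set M.Num)) := by
  obtain ⟨p, t, -, h⟩ := hf
  obtain ⟨S⟩ := exists_set M
  rcases hX with ⟨hX | ⟨Y, hX⟩⟩
  · refine ⟨p, fun _ => S, .mem t 0, .mem _ _, fun γ v V hv hV => ?_⟩
    simp only [Sat, h γ v hv, hV.arg, hX]
  · refine ⟨p, fun _ => Y, .mem t 1, .mem _ _, fun γ v V hv hV => ?_⟩
    simp only [Sat, h γ v hv, hV.params 0, hX]

instance D0.eq {f g : Γ → M.Num} [hf : Tm f] [hg : Tm g] :
    D0 (fun γ => f γ = g γ) := by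
  obtain ⟨p, hf⟩ := hf
  obtain ⟨q, hg⟩ := hg
  obtain ⟨t, ht, h⟩ := hf.left q
  obtain ⟨s, hs, h'⟩ := hg.right p
  obtain ⟨S⟩ := exists_set M
  exact ⟨_, fun _ => S, .eq t s, .eq _ _, fun γ v V hv _ => by rw [Sat, h γ v hv, h' γ v hv]⟩

instance D0.lt {f g : Γ → M.Num} [hf : Tm f] [hg : Tm g] :
    D0 (fun γ => f γ < g γ) := by
  obtain ⟨p, hf⟩ := hf
  obtain ⟨q, hg⟩ := hg
  obtain ⟨t, ht, h⟩ := hf.left q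
  obtain ⟨s, hs, h'⟩ := hg.right p
  obtain ⟨S⟩ := exists_set M
  exact ⟨_, fun _ => S, .lt t s, .lt _ _, fun γ v V hv _ => by rw [Sat, h γ v hv, h' γ v hv]; rfl⟩

instance D0.not {P : Γ → Prop} [hP : D0 P] : D0 (fun γ => ¬ P γ) := by
  obtain ⟨p, S, φ, hφ, h⟩ := hP
  exact ⟨p, S, .neg φ, .neg hφ, fun γ v V hv hV => by rw [Sat, h γ v V hv hV]⟩

instance D0.and {P Q : Γ → Prop} [hP : D0 P] [hQ : D0 Q] :
    D0 (fun γ => P γ ∧ Q γ) := by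
  obtain ⟨p, S, hP⟩ := hP
  obtain ⟨q, T, hQ⟩ := hQ
  obtain ⟨φ, hφ, h⟩ := hP.left q T
  obtain ⟨ψ, hψ, h'⟩ := hQ.right p S
  exact ⟨_, _, .and φ ψ, .and hφ hψ, fun γ v V hv hV => by rw [Sat, h γ v V hv hV, h' γ v V hv hV]⟩

instance D0.or {P Q : Γ → Prop} [hP : D0 P] [hQ : D0 Q] :
    D0 (fun γ => P γ ∨ Q γ) := by
  obtain ⟨p, S, hP⟩ := hP
  obtain ⟨q, T, hQ⟩ := hQ
  obtain ⟨φ, hφ, h⟩ := hP.left q T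
  obtain ⟨ψ, hψ, h'⟩ := hQ.right p S
  exact ⟨_, _, .or φ ψ, .or hφ hψ, fun γ v V hv hV => by rw [Sat, h γ v V hv hV, h' γ v V hv hV]⟩

instance D0.imp {P Q : Γ → Prop} [hP : D0 P] [hQ : D0 Q] :
    D0 (fun γ => P γ → Q γ) := by
  obtain ⟨p, S, hP⟩ := hP
  obtain ⟨q, T, hQ⟩ := hQ
  obtain ⟨φ, hφ, h⟩ := hP.left q T
  obtain ⟨ψ, hψ, h'⟩ := hQ.right p S
  exact ⟨_, _, .imp φ ψ, .imp hφ hψ, fun γ v V hv hV => by rw [Sat, h γ v V hv hV, h' γ v V hv hV]⟩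

instance D0.iff {P Q : Γ → Prop} [hP : D0 P] [hQ : D0 Q] : D0 (fun γ => P γ ↔ Q γ) := by
  simp only [iff_def]
  infer_instance

instance D0.ball {t : Γ → M.Num} {P : Γ → M.Num → Prop} [ht : Tm t]
    [hP : D0 (fun x : Γ × M.Num => P x.1 x.2)] : D0 (fun γ => ∀ a < t γ, P γ a) := by
  obtain ⟨p, ht⟩ := ht
  obtain ⟨q, S, hP⟩ := hP
  obtain ⟨s, hs, h⟩ := ht.left q
  obtain ⟨φ, hφ, h'⟩ := hP.right p S
  -- The quantified variable is the first even place not used by the context; the even variables of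
  -- `s` lie below it.
  refine ⟨interleave p q, interleave S S, .all (2 * Ctx.len Γ) (.imp (.lt (.var (2 * Ctx.len Γ)) s) φ),
    .ball (fun hi => by have := hs _ hi (by omega); omega) hφ,
    fun γ v V hv hV => forall_congr' fun a => ?_⟩
  rw [Sat, Sat, h' (γ, a) _ V (hv.update a) (SetFits.fst.2 hV), h γ _ (hv.update a).fst, eval,
    Function.update_self]
  rfl

instance D0.bex {t : Γ → M.Num} {P : Γ → M.Num → Prop} [ht : Tm t]
    [hP : D0 (fun x : Γ × M.Num => P x.1 x.2)] : D0 (fun γ => ∃ a < t γ, P γ a) := by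
  have := D0.not (P := fun γ => ∀ a < t γ, ¬ P γ a)
  simpa only [not_forall, not_not, exists_prop] using this

/-! ## Semantic forms of induction and comprehension -/

/-- The base context has no numbers, so only the odd places matter, and `(2 * i + 1) / 2 = i`. -/
theorem numFits_params (X : M.sets) (p : ℕ → M.Num) : NumFits X p fun i => p (i / 2) :=
  ⟨fun i hi => absurd hi (Nat.not_lt_zero i), fun i => congrArg p (by omega)⟩

theorem setFits_params (γ : Γ) (S : ℕ → M.sets) :
    SetFits γ S fun i => Nat.casesOn i (Ctx.set γ) S := ⟨rfl, fun _ => rfl⟩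

variable [hM : Fact M.ModelsRCA0]

theorem sigma_induction (R : M.Num → M.Num → Prop)
    [hR : D0 fun x : (M.sets × M.Num) × M.Num => R x.1.2 x.2] (h0 : ∃ a, R 0 a)
    (hs : ∀ n, (∃ a, R n a) → ∃ a, R (n + 1) a) (n : M.Num) : ∃ a, R n a := by
  obtain ⟨p, S, φ, hφ, h⟩ := hR
  obtain ⟨X⟩ := exists_set M
  have key : ∀ n, M.Sat (.ex 2 φ) (Function.update (fun i => p (i / 2)) 0 n)
      (fun i => Nat.casesOn i X S) ↔ ∃ a, R n a := fun n => exists_congr fun a =>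
    h ((X, n), a) _ _ (((numFits_params X p).update n).update a) (setFits_params _ S)
  exact (key n).1 (hM.out.induction _ ⟨2, φ, hφ, rfl⟩ 0 _ _ ((key 0).2 h0)
    (fun n hn => (key _).2 (hs n ((key n).1 hn))) n)

theorem D0.induction (P : M.Num → Prop) [hP : D0 fun x : M.sets × M.Num => P x.2] (h0 : P 0)
    (hs : ∀ n, P n → P (n + 1)) (n : M.Num) : P n := by
  have := sigma_induction (R := fun n _ => P n) (hR := D0.fst (P := fun x : M.sets × M.Num => P x.2)) ⟨0, h0⟩
    (fun n ⟨a, ha⟩ => ⟨a, hs n ha⟩) n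
  exact this.choose_spec

theorem delta_comprehension (R R' : M.Num → M.Num → Prop)
    [hR : D0 fun x : (M.sets × M.Num) × M.Num => R x.1.2 x.2]
    [hR' : D0 fun x : (M.sets × M.Num) × M.Num => R' x.1.2 x.2]
    (h : ∀ n, (∃ a, R n a) ↔ ¬ ∃ a, R' n a) : ∃ X : M.sets, ∀ n, n ∈ (X : Set M.Num) ↔ ∃ a, R n a := by
  obtain ⟨p, S, hR⟩ := hR
  obtain ⟨q, T, hR'⟩ := D0.not (hP := hR')
  obtain ⟨φ, hφ, h1⟩ := hR.left q T
  obtain ⟨ψ, hψ, h2⟩ := hR'.right p S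
  obtain ⟨X⟩ := exists_set M
  have key : ∀ n, M.Sat (.ex 2 φ) (Function.update (fun i => interleave p q (i / 2)) 0 n)
      (fun i => Nat.casesOn i X (interleave S T)) ↔ ∃ a, R n a := fun n => exists_congr fun a =>
    h1 ((X, n), a) _ _ (((numFits_params X _).update n).update a) (setFits_params _ _)
  have key' : ∀ n, M.Sat (.all 2 ψ) (Function.update (fun i => interleave p q (i / 2)) 0 n)
      (fun i => Nat.casesOn i X (interleave S T)) ↔ ∀ a, ¬ R' n a := fun n => forall_congr' fun a =>
    h2 ((X, n), a) _ _ (((numFits_params X _).update n).update a) (setFits_params _ _)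
  obtain ⟨Y, hY, h3⟩ := hM.out.comprehension _ _ ⟨2, φ, hφ, rfl⟩ ⟨2, ψ, hψ, rfl⟩ 0 _ _
    fun n => ((key n).trans (h n)).trans (not_exists.trans (key' n).symm)
  exact ⟨⟨Y, hY⟩, fun n => (h3 n).trans (key n)⟩

theorem D0.comprehension (P : M.Num → Prop) [hP : D0 fun x : M.sets × M.Num => P x.2] :
    ∃ X : M.sets, ∀ n, n ∈ (X : Set M.Num) ↔ P n := by
  obtain ⟨X, hX⟩ := delta_comprehension (R := fun n _ => P n) (R' := fun n _ => ¬ P n)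
    (hR := D0.fst (P := fun x : M.sets × M.Num => P x.2))
    (hR' := D0.fst (P := fun x : M.sets × M.Num => ¬ P x.2)) (fun n => by simp)
  exact ⟨X, fun n => (hX n).trans (by simp)⟩

/-! ## Arithmetic in a model of `RCA₀` -/

variable {M : L2Structure.{u}} [hM : Fact M.ModelsRCA0]

namespace Num

theorem add_zero' (a : M.Num) : a + 0 = a := hM.out.basic.add_zero a

theorem add_succ' (a b : M.Num) : a + (b + 1) = a + b + 1 := hM.out.basic.add_succ a b

theorem mul_zero' (a : M.Num) : a * 0 = 0 := hM.out.basic.mul_zero a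

theorem mul_succ' (a b : M.Num) : a * (b + 1) = a * b + a := hM.out.basic.mul_succ a b

theorem lt_succ_iff (a b : M.Num) : a < b + 1 ↔ a < b ∨ a = b := hM.out.basic.lt_succ_iff a b

theorem not_lt_zero' (a : M.Num) : ¬ a < 0 := hM.out.basic.not_lt_zero a

theorem zero_add' (a : M.Num) : 0 + a = a := by
  refine D0.induction (fun a => 0 + a = a) (add_zero' 0) (fun n h => ?_) a
  rw [add_succ', h]

theorem add_assoc' (a b c : M.Num) : a + b + c = a + (b + c) := by
  refine D0.induction (fun c => a + b + c = a + (b + c)) ?_ (fun n h => ?_) c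
  · rw [add_zero', add_zero']
  · rw [add_succ', h, add_succ', add_succ']

theorem one_add' (a : M.Num) : 1 + a = a + 1 := by
  refine D0.induction (fun a => 1 + a = a + 1) ?_ (fun n h => ?_) a
  · rw [add_zero', zero_add']
  · rw [add_succ', h]

theorem add_comm' (a b : M.Num) : a + b = b + a := by
  refine D0.induction (fun b => a + b = b + a) ?_ (fun n h => ?_) b
  · rw [add_zero', zero_add']
  · rw [add_succ', h, add_assoc', ← one_add' a, add_assoc']

theorem mul_add' (a b c : M.Num) : a * (b + c) = a * b + a * c := by
  refine D0.induction (fun c => a * (b + c) = a * b + a * c) ?_ (fun n h => ?_) c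
  · rw [add_zero', mul_zero', add_zero']
  · rw [add_succ', mul_succ', h, mul_succ', add_assoc']

theorem zero_mul' (a : M.Num) : 0 * a = 0 := by
  refine D0.induction (fun a => 0 * a = 0) (mul_zero' 0) (fun n h => ?_) a
  rw [mul_succ', h, add_zero']

theorem succ_mul' (a b : M.Num) : (a + 1) * b = a * b + b := by
  refine D0.induction (fun b => (a + 1) * b = a * b + b) ?_ (fun n h => ?_) b
  · rw [mul_zero', mul_zero', add_zero']
  · rw [mul_succ', h, mul_succ', add_succ', add_succ', add_assoc' (a * n) n a, add_comm' n a,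
      add_assoc' (a * n) a n]

theorem mul_comm' (a b : M.Num) : a * b = b * a := by
  refine D0.induction (fun b => a * b = b * a) ?_ (fun n h => ?_) b
  · rw [mul_zero', zero_mul']
  · rw [mul_succ', h, succ_mul']

theorem mul_assoc' (a b c : M.Num) : a * b * c = a * (b * c) := by
  refine D0.induction (fun c => a * b * c = a * (b * c)) ?_ (fun n h => ?_) c
  · rw [mul_zero', mul_zero', mul_zero']
  · rw [mul_succ', h, mul_succ', mul_add']

theorem mul_one' (a : M.Num) : a * 1 = a := by
  rw [← zero_add' (1 : M.Num), mul_succ', mul_zero', zero_add']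

theorem add_right_cancel' {a b : M.Num} (c : M.Num) : a + c = b + c → a = b := by
  refine D0.induction (fun c => a + c = b + c → a = b) ?_ (fun n h e => ?_) c
  · rw [add_zero', add_zero']; exact _root_.id
  · rw [add_succ', add_succ'] at e
    exact h (hM.out.basic.succ_inj _ _ e)

end Num


/-! ### The numbers as an ordered semiring -/

instance : CommSemiring M.Num where
  add_assoc := Num.add_assoc'
  zero_add := Num.zero_add'
  add_zero := Num.add_zero'
  add_comm := Num.add_comm'
  left_distrib := Num.mul_add'
  right_distrib a b c := by rw [Num.mul_comm', Num.mul_add', Num.mul_comm' c, Num.mul_comm' c]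
  zero_mul := Num.zero_mul'
  mul_zero := Num.mul_zero'
  mul_assoc := Num.mul_assoc'
  one_mul a := by rw [Num.mul_comm', Num.mul_one']
  mul_one := Num.mul_one'
  mul_comm := Num.mul_comm'
  nsmul := nsmulRec
  npow := npowRec

instance : IsCancelAdd M.Num :=
  by
  have : IsRightCancelAdd M.Num := ⟨fun c _ _ h => Num.add_right_cancel' c h⟩
  exact AddCommMagma.IsRightCancelAdd.toIsCancelAdd _

/-- The axioms describe `<` only through successors. The difference is found by `Σ⁰₁`-induction on
`b`; the order laws then become identities of arithmetic. -/
theorem Num.lt_iff_exists {a b : M.Num} : a < b ↔ ∃ c, b = a + c + 1 := by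
  constructor
  · intro h
    obtain ⟨c, hc⟩ := sigma_induction (fun b c => a < b → b = a + c + 1)
      ⟨0, fun h => absurd h (Num.not_lt_zero' a)⟩ (fun n ⟨c, hc⟩ => by
        by_cases hn : a < n
        · exact ⟨c + 1, fun _ => by rw [hc hn, add_assoc a c 1]⟩
        · refine ⟨0, fun h => ?_⟩
          rw [((Num.lt_succ_iff a n).1 h).resolve_left hn, add_zero]) b
    exact ⟨c, hc h⟩
  · rintro ⟨c, rfl⟩
    refine D0.induction (fun c => a < a + c + 1) ?_ (fun n h => ?_) c
    · exact (Num.lt_succ_iff _ _).2 (Or.inr (add_zero a).symm)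
    · exact (Num.lt_succ_iff _ _).2 (Or.inl (by rwa [← add_assoc]))

theorem Num.succ_ne_zero (a : M.Num) : a + 1 ≠ 0 := hM.out.basic.succ_ne_zero a

theorem Num.lt_irrefl' (a : M.Num) : ¬ a < a := by
  rw [Num.lt_iff_exists]
  rintro ⟨c, h⟩
  rw [add_assoc, left_eq_add] at h
  exact Num.succ_ne_zero c h

theorem Num.lt_trans' {a b c : M.Num} (h : a < b) (h' : b < c) : a < c := by
  obtain ⟨d, rfl⟩ := Num.lt_iff_exists.1 h
  obtain ⟨e, rfl⟩ := Num.lt_iff_exists.1 h'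
  exact Num.lt_iff_exists.2 ⟨d + 1 + e, by ring⟩

theorem Num.trichotomy (a b : M.Num) : a < b ∨ a = b ∨ b < a := by
  refine D0.induction (fun b => a < b ∨ a = b ∨ b < a) ?_ (fun n h => ?_) b
  · refine D0.induction (fun a => a < 0 ∨ a = 0 ∨ 0 < a) (Or.inr (Or.inl rfl)) (fun n _ => ?_) a
    exact Or.inr (Or.inr (Num.lt_iff_exists.2 ⟨n, by rw [zero_add]⟩))
  · rcases h with h | h | h
    · exact Or.inl ((Num.lt_succ_iff _ _).2 (Or.inl h))
    · exact Or.inl ((Num.lt_succ_iff _ _).2 (Or.inr h))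
    · obtain ⟨c, rfl⟩ := Num.lt_iff_exists.1 h
      refine D0.induction (fun c => n + c + 1 < n + 1 ∨ n + c + 1 = n + 1 ∨ n + 1 < n + c + 1) ?_
        (fun c _ => ?_) c
      · rw [add_zero]; exact Or.inr (Or.inl rfl)
      · exact Or.inr (Or.inr (Num.lt_iff_exists.2 ⟨c, by ring⟩))

noncomputable instance : LinearOrder M.Num where
  lt := (· < ·)
  le a b := a < b ∨ a = b
  le_refl a := Or.inr rfl
  le_trans a b c := by
    rintro (h | rfl) (h' | rfl)
    exacts [Or.inl (Num.lt_trans' h h'), Or.inl h, Or.inl h', Or.inr rfl]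
  lt_iff_le_not_ge a b := by
    refine ⟨fun h => ⟨Or.inl h, ?_⟩, ?_⟩
    · rintro (h' | rfl)
      exacts [Num.lt_irrefl' _ (Num.lt_trans' h h'), Num.lt_irrefl' _ h]
    · rintro ⟨h | rfl, h'⟩
      exacts [h, (h' (Or.inr rfl)).elim]
  le_antisymm a b := by
    rintro (h | rfl) (h' | h')
    exacts [(Num.lt_irrefl' _ (Num.lt_trans' h h')).elim, h'.symm, rfl, rfl]
  le_total a b := by
    rcases Num.trichotomy a b with h | h | h
    exacts [Or.inl (Or.inl h), Or.inl (Or.inr h), Or.inr (Or.inl h)]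
  toDecidableLE := Classical.decRel _

instance : CanonicallyOrderedAdd M.Num where
  exists_add_of_le {a b} := by
    rintro (h | rfl)
    · obtain ⟨c, rfl⟩ := Num.lt_iff_exists.1 h
      exact ⟨c + 1, add_assoc _ _ _⟩
    · exact ⟨0, (add_zero a).symm⟩
  le_add_self a b := by
    rcases Num.trichotomy 0 b with h | h | h
    · obtain ⟨c, rfl⟩ := Num.lt_iff_exists.1 h
      exact Or.inl (Num.lt_iff_exists.2 ⟨c, by ring⟩)
    · exact Or.inr (by rw [← h, zero_add])
    · exact (Num.not_lt_zero' b h).elim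
  le_self_add a b := by
    rcases Num.trichotomy 0 b with h | h | h
    · obtain ⟨c, rfl⟩ := Num.lt_iff_exists.1 h
      exact Or.inl (Num.lt_iff_exists.2 ⟨c, by ring⟩)
    · exact Or.inr (by rw [← h, add_zero])
    · exact (Num.not_lt_zero' b h).elim

instance : Nontrivial M.Num := ⟨⟨0 + 1, 0, Num.succ_ne_zero 0⟩⟩

instance : IsStrictOrderedRing M.Num where
  add_le_add_left a b h c := by
    obtain ⟨d, rfl⟩ := exists_add_of_le h
    rw [add_right_comm]; exact le_self_add
  le_of_add_le_add_left a b c h := by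
    obtain ⟨d, h⟩ := exists_add_of_le h
    rw [add_assoc] at h
    rw [add_left_cancel h]; exact le_self_add
  zero_le_one := zero_le
  mul_lt_mul_of_pos_left a h b c h' := by
    obtain ⟨d, rfl⟩ := Num.lt_iff_exists.1 h
    obtain ⟨e, rfl⟩ := Num.lt_iff_exists.1 h'
    exact Num.lt_iff_exists.2 ⟨d * e + d + e, by ring⟩
  mul_lt_mul_of_pos_right a h b c h' := by
    obtain ⟨d, rfl⟩ := Num.lt_iff_exists.1 h
    obtain ⟨e, rfl⟩ := Num.lt_iff_exists.1 h'
    exact Num.lt_iff_exists.2 ⟨d * e + d + e, by ring⟩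

theorem Num.lt_add_one_iff {a b : M.Num} : a < b + 1 ↔ a ≤ b := Num.lt_succ_iff a b

theorem Num.add_one_le_iff {a b : M.Num} : a + 1 ≤ b ↔ a < b := by
  rw [← Num.lt_add_one_iff, add_lt_add_iff_right]

variable {Γ : Type u} [Ctx M Γ]

instance D0.le {f g : Γ → M.Num} [Tm f] [Tm g] : D0 (fun γ => f γ ≤ g γ) := by
  simp only [← not_lt]
  infer_instance

theorem Num.dvd_iff_bounded {a b : M.Num} : a ∣ b ↔ ∃ c < b + 1, b = a * c := by
  constructor
  · rintro ⟨c, rfl⟩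
    -- For `a = 0` the given cofactor may be too large, and `0` serves instead.
    rcases eq_or_ne a 0 with rfl | ha
    · exact ⟨0, Num.lt_add_one_iff.2 (zero_le), by simp⟩
    · exact ⟨c, Num.lt_add_one_iff.2 (le_mul_of_one_le_left zero_le
        (by rw [← zero_add 1, Num.add_one_le_iff]; exact pos_iff_ne_zero.2 ha)), rfl⟩
  · rintro ⟨c, -, rfl⟩
    exact Dvd.intro _ rfl

instance D0.dvd {f g : Γ → M.Num} [Tm f] [Tm g] : D0 (fun γ => f γ ∣ g γ) := by
  simp only [Num.dvd_iff_bounded]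
  infer_instance

/-! ### Least and greatest elements -/

/-- Without a least element every witness could be lowered, so induction on `b` would give a witness
`x` with `x + b ≤ n`, which is absurd for `b = n + 1`. Definability is assumed in all contexts
because `R` is used under bounded quantifiers. -/
theorem sigma_least (R : M.Num → M.Num → Prop)
    (h : ∃ n a, R n a)
    (hR : ∀ (Γ : Type u) [Ctx M Γ] (f g : Γ → M.Num) [Tm f] [Tm g], D0 fun γ => R (f γ) (g γ) := by
      intros; infer_instance) :
    ∃ n, (∃ a, R n a) ∧ ∀ m < n, ∀ a, ¬ R m a := by
  by_contra! H
  obtain ⟨n, a, hn⟩ := h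
  have key := sigma_induction (fun b w => ∃ x < w, ∃ a < w, x + b ≤ n ∧ R x a)
    ⟨n + a + 1, n, Num.lt_add_one_iff.2 le_self_add, a, Num.lt_add_one_iff.2 le_add_self,
      by rw [add_zero], hn⟩ (fun b ⟨w, x, _, a, _, hx, hR⟩ => by
      obtain ⟨m, hm, c, hc⟩ := H x ⟨a, hR⟩
      refine ⟨m + c + 1, m, Num.lt_add_one_iff.2 le_self_add, c, Num.lt_add_one_iff.2 le_add_self,
        ?_, hc⟩
      rw [add_comm b, ← add_assoc]
      exact (add_le_add_left (Num.add_one_le_iff.2 hm) b).trans hx) (n + 1)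
  obtain ⟨w, x, _, a, _, hx, _⟩ := key
  exact absurd (le_add_self.trans hx) (not_le.2 (Num.lt_add_one_iff.2 le_rfl))

theorem D0.least (P : M.Num → Prop)
    (h : ∃ n, P n)
    (hP : ∀ (Γ : Type u) [Ctx M Γ] (f : Γ → M.Num) [Tm f], D0 fun γ => P (f γ) := by
      intros; infer_instance) :
    ∃ n, P n ∧ ∀ m < n, ¬ P m := by
  obtain ⟨n, hn⟩ := h
  obtain ⟨n, ⟨a, ha⟩, h⟩ := sigma_least (fun n _ => P n) ⟨n, n, hn⟩
  exact ⟨n, ha, fun m hm => h m hm a⟩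

/-- The distance `d` from the element to the bound is minimised. -/
theorem D0.greatest_lt (P : M.Num → Prop)
    {b : M.Num} (h : ∃ n < b, P n)
    (hP : ∀ (Γ : Type u) [Ctx M Γ] (f : Γ → M.Num) [Tm f], D0 fun γ => P (f γ) := by
      intros; infer_instance) :
    ∃ n < b, P n ∧ ∀ m < b, P m → m ≤ n := by
  obtain ⟨n, hn, h⟩ := h
  obtain ⟨c, rfl⟩ := exists_add_of_le hn.le
  obtain ⟨d, ⟨a, h1, h2, h3⟩, h4⟩ := sigma_least (fun d a => a + d = n + c ∧ a < n + c ∧ P a)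
    ⟨c, n, rfl, hn, h⟩
  refine ⟨a, h2, h3, fun m hm hPm => ?_⟩
  by_contra! hlt
  obtain ⟨e, he⟩ := exists_add_of_le hm.le
  refine h4 e ?_ m ⟨he.symm, hm, hPm⟩
  by_contra! hde
  exact absurd ((add_lt_add_of_lt_of_le hlt hde).trans_eq he.symm) (by rw [h1]; exact lt_irrefl _)


/-! ## Pairs, and parity by means of coded finite sets -/

variable {M : L2Structure.{u}} [hM : Fact M.ModelsRCA0] {Γ : Type u} [Ctx M Γ]

/-- A pairing function. -/
def pair (x y : M.Num) : M.Num := (x + y) * (x + y) + x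

omit hM in
theorem pair_def (x y : M.Num) : pair x y = (x + y) * (x + y) + x := rfl

instance Tm.pair {f g : Γ → M.Num} [Tm f] [Tm g] : Tm (fun γ => pair (f γ) (g γ)) := by
  simp only [pair_def]
  infer_instance

theorem le_mul_self (x : M.Num) : x ≤ x * x := by
  rcases eq_or_ne x 0 with rfl | hx
  · simp
  · exact le_mul_of_one_le_left zero_le
      (by rw [← zero_add 1, Num.add_one_le_iff]; exact pos_iff_ne_zero.2 hx)

theorem left_le_pair (x y : M.Num) : x ≤ pair x y := le_add_self

theorem right_le_pair (x y : M.Num) : y ≤ pair x y :=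
  (le_add_self.trans (le_mul_self (x + y))).trans le_self_add

/-- Consecutive squares `s * s` and `(s + 1) * (s + 1)` are `2 * s + 1` apart, which exceeds the
summand `x ≤ s`. -/
theorem pair_lt_pair {x y x' y' : M.Num} (h : x + y < x' + y') : pair x y < pair x' y' := by
  obtain ⟨c, hc⟩ := Num.lt_iff_exists.1 h
  rw [pair, pair, hc, Num.lt_iff_exists]
  exact ⟨(x + y) * c + c * (x + y) + c * c + c + c + x + y + y + x', by ring⟩

theorem pair_inj {x y x' y' : M.Num} (h : pair x y = pair x' y') : x = x' ∧ y = y' := by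
  have hs : x + y = x' + y' := by
    rcases lt_trichotomy (x + y) (x' + y') with h' | h' | h'
    exacts [absurd h (pair_lt_pair h').ne, h', absurd h (pair_lt_pair h').ne']
  rw [pair, pair, hs] at h
  have hx := add_left_cancel h
  subst hx
  exact ⟨rfl, add_left_cancel hs⟩

/-- Membership in the finite set coded by `a` and `b`. -/
def CodeMem (a b i : M.Num) : Prop := 1 + (i + 1) * a ∣ b

instance D0.codeMem {f g h : Γ → M.Num} [Tm f] [Tm g] [Tm h] :
    D0 (fun γ => CodeMem (f γ) (g γ) (h γ)) := by
  unfold CodeMem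
  infer_instance

theorem dvd_of_dvd_add {u b c : M.Num} (hu : 0 < u) (hc : u ∣ c) (h : u ∣ b + c) : u ∣ b := by
  obtain ⟨x, rfl⟩ := hc
  obtain ⟨y, hy⟩ := h
  have hxy : x ≤ y := le_of_mul_le_mul_left (le_add_self.trans hy.le) hu
  obtain ⟨w, rfl⟩ := exists_add_of_le hxy
  refine ⟨w, add_right_cancel (b := u * x) (hy.trans (by ring))⟩

/-- The two moduli are coprime, as they differ by `|i - j| * a` and `|i - j|` divides `a`.
Explicitly, let `a = |i - j| * e` and work modulo `1 + (i + 1) * a`. Then `b * |i - j| * a`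
vanishes; multiplying by `(i + 1) * e * (i + 1)` gives `b` times the square of `(i + 1) * a`, which
is `-1`. The witnesses below express this without subtraction. -/
theorem codeMem_mul_iff {a b i j : M.Num} (hij : i ≠ j)
    (ha : ∀ d, 0 < d → d ≤ i ∨ d ≤ j → d ∣ a) :
    CodeMem a (b * (1 + (j + 1) * a)) i ↔ CodeMem a b i := by
  refine ⟨fun h => ?_, fun h => Dvd.dvd.mul_right h _⟩
  unfold CodeMem at h ⊢
  have pos : 0 < 1 + (i + 1) * a := zero_lt_one.trans_le le_self_add
  rcases lt_or_gt_of_ne hij with h' | h'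
  · obtain ⟨c, rfl⟩ := Num.lt_iff_exists.1 h'
    obtain ⟨e, he⟩ := ha (c + 1) (zero_lt_one.trans_le le_add_self)
      (Or.inr (by rw [add_assoc]; exact le_add_self))
    obtain ⟨w, hw⟩ := h
    refine dvd_of_dvd_add (c := (1 + (i + 1) * a) * (b * (i + 1) * e * (i + c + 1 + 1))) pos
      (Dvd.intro _ rfl) ⟨b + (i + 1) * e * (i + 1) * w, ?_⟩
    calc _ = (1 + (i + 1) * a) * b + (i + 1) * e * (i + 1) * (b * (1 + (i + c + 1 + 1) * a)) := by
          rw [he]; ring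
      _ = _ := by rw [hw]; ring
  · obtain ⟨c, rfl⟩ := Num.lt_iff_exists.1 h'
    obtain ⟨e, he⟩ := ha (c + 1) (zero_lt_one.trans_le le_add_self)
      (Or.inl (by rw [add_assoc]; exact le_add_self))
    refine dvd_of_dvd_add (c := (j + c + 1 + 1) * e * (j + c + 1 + 1) * (b * (1 + (j + 1) * a))) pos
      (h.mul_left _) ⟨b + (j + c + 1 + 1) * e * (j + 1) * b, ?_⟩
    rw [he]; ring

theorem codeMem_mul_self (a b i : M.Num) : CodeMem a (b * (1 + (i + 1) * a)) i := Dvd.intro_left _ rfl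

theorem exists_dvd_all (n : M.Num) : ∃ a, 0 < a ∧ ∀ d < n + 1, 0 < d → d ∣ a := by
  refine sigma_induction (fun n a => 0 < a ∧ ∀ d < n + 1, 0 < d → d ∣ a) ⟨1, zero_lt_one, ?_⟩
    (fun n ⟨a, ha, h⟩ => ⟨a * (n + 1), ?_, fun d hd h0 => ?_⟩) n
  · intro d hd h0
    exact absurd h0 (not_lt.2 (Num.lt_add_one_iff.1 hd))
  · exact mul_pos ha (zero_lt_one.trans_le le_add_self)
  · rcases (Num.lt_add_one_iff.1 hd).eq_or_lt with rfl | h'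
    · exact Dvd.intro_left _ rfl
    · exact (h d h' h0).mul_right _

/-- The code `(a, b)` describes the parity of `X ∩ [0, z)` for all `z ≤ y`. -/
def ParityCode (X : M.sets) (y a b : M.Num) : Prop :=
  ¬ CodeMem a b 0 ∧ ∀ z < y, (CodeMem a b (z + 1) ↔ ¬ (CodeMem a b z ↔ z ∈ (X : Set M.Num)))

instance D0.parityCode {f g h : Γ → M.Num} {X : Γ → M.sets} [Tm f] [Tm g] [Tm h] [SV X] :
    D0 (fun γ => ParityCode (X γ) (f γ) (g γ) (h γ)) := by
  unfold ParityCode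
  infer_instance

/-- For fixed `a`, the number `k + 1` is added to the coded set, by multiplying `b` with its
modulus, when the parity becomes odd. The induction also records that nothing beyond `k` is coded
yet, so that an unchanged `b` means even. -/
theorem exists_parityCode (X : M.sets) (y : M.Num) : ∃ a b, ParityCode X y a b := by
  obtain ⟨a, ha0, ha⟩ := exists_dvd_all y
  have key := sigma_induction
    (fun k b => k ≤ y → ParityCode X k a b ∧ ∀ i < y + 1, k < i → ¬ CodeMem a b i)
    ⟨1, fun _ => ?_⟩ (fun k ⟨b, hb⟩ => ?_) y
  · obtain ⟨b, hb⟩ := key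
    exact ⟨a, b, (hb le_rfl).1⟩
  -- The code `b = 1` describes the empty set because `a > 0` makes every modulus exceed `1`.
  · have h1 : ∀ i, ¬ CodeMem a 1 i := by
      rintro i ⟨c, hc⟩
      have hc0 : 1 ≤ c := by
        rw [← zero_add 1, Num.add_one_le_iff, pos_iff_ne_zero]
        rintro rfl
        rw [mul_zero] at hc
        exact one_ne_zero hc
      have h2 : 1 + (i + 1) * a ≤ 1 := (le_mul_of_one_le_right zero_le hc0).trans hc.ge
      have h3 : 0 < (i + 1) * a := mul_pos (zero_lt_one.trans_le le_add_self) ha0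
      exact absurd h2 (not_le.2 (lt_add_of_pos_right 1 h3))
    exact ⟨⟨h1 0, fun z hz => absurd hz (not_lt.2 zero_le)⟩, fun i _ _ => h1 i⟩
  · by_cases hk : k + 1 ≤ y
    swap
    · exact ⟨0, fun h => absurd h hk⟩
    have hky : k < y := Num.add_one_le_iff.1 hk
    obtain ⟨⟨h0, hc⟩, hn⟩ := hb hky.le
    have hkk : k < k + 1 := Num.lt_add_one_iff.2 le_rfl
    have hn' := hn (k + 1) (Num.lt_add_one_iff.2 hk) hkk
    by_cases h : CodeMem a b k ↔ k ∈ (X : Set M.Num)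
    · refine ⟨b, fun _ => ⟨⟨h0, fun z hz => ?_⟩, fun i hi h3 =>
        hn i hi (hkk.trans h3)⟩⟩
      rcases (Num.lt_add_one_iff.1 hz).eq_or_lt with rfl | hz'
      · exact iff_of_false hn' (not_not.2 h)
      · exact hc z hz'
    · have hmul : ∀ i ≤ y, i ≠ k + 1 →
          (CodeMem a (b * (1 + (k + 1 + 1) * a)) i ↔ CodeMem a b i) := fun i hi hik =>
        codeMem_mul_iff hik fun d hd h => ha d (Num.lt_add_one_iff.2 (h.elim (·.trans hi) (·.trans hk))) hd
      refine ⟨b * (1 + (k + 1 + 1) * a), fun _ => ⟨⟨?_, fun z hz => ?_⟩, fun i hi h3 => ?_⟩⟩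
      · rwa [hmul 0 zero_le (Num.succ_ne_zero k).symm]
      · have hzk := Num.lt_add_one_iff.1 hz
        rw [hmul z (hzk.trans hky.le) hz.ne]
        rcases hzk.eq_or_lt with rfl | hz'
        · exact iff_of_true (codeMem_mul_self _ _ _) h
        · rw [hmul (z + 1) ((Num.add_one_le_iff.2 hz').trans hky.le)
            (fun e => hz'.ne (add_right_cancel e))]
          exact hc z hz'
      · rw [hmul i (Num.lt_add_one_iff.1 hi) h3.ne']
        exact hn i hi (hkk.trans h3)

theorem ParityCode.unique {X : M.sets} {y a b a' b' : M.Num} (h : ParityCode X y a b)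
    (h' : ParityCode X y a' b') : CodeMem a b y ↔ CodeMem a' b' y := by
  refine D0.induction (fun z => z ≤ y → (CodeMem a b z ↔ CodeMem a' b' z)) (fun _ => ?_)
    (fun z ih hz => ?_) y le_rfl
  · exact iff_of_false h.1 h'.1
  · have hz' := Num.add_one_le_iff.1 hz
    rw [h.2 z hz', h'.2 z hz', ih hz'.le]

/-- The set `X ∩ [0, y)` has an odd number of elements. -/
def OddBelow (X : M.sets) (y : M.Num) : Prop := ∃ a b, ParityCode X y a b ∧ CodeMem a b y

theorem ParityCode.oddBelow_iff {X : M.sets} {y a b : M.Num} (h : ParityCode X y a b) :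
    OddBelow X y ↔ CodeMem a b y :=
  ⟨fun ⟨_, _, h', hm⟩ => (h.unique h').2 hm, fun hm => ⟨a, b, h, hm⟩⟩

theorem not_oddBelow_of_forall_notMem {X : M.sets} {y : M.Num}
    (hX : ∀ z < y, z ∉ (X : Set M.Num)) : ¬ OddBelow X y := by
  obtain ⟨a, b, h⟩ := exists_parityCode X y
  rw [h.oddBelow_iff]
  refine D0.induction (fun z => z ≤ y → ¬ CodeMem a b z) (fun _ => h.1) (fun z ih hz => ?_) y le_rfl
  have hz' := Num.add_one_le_iff.1 hz
  rw [h.2 z hz', not_not]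
  exact iff_of_false (ih hz'.le) (hX z hz')

/-- The two parities agree up to `x` and are opposite from `x + 1` on. -/
theorem oddBelow_erase {X Y : M.sets} {x : M.Num} (hx : x ∈ (X : Set M.Num))
    (hXY : ∀ z, z ∈ (Y : Set M.Num) ↔ z ∈ (X : Set M.Num) ∧ z ≠ x) {y : M.Num} (hy : x < y) :
    OddBelow Y y ↔ ¬ OddBelow X y := by
  obtain ⟨a, b, h⟩ := exists_parityCode X y
  obtain ⟨c, d, h'⟩ := exists_parityCode Y y
  rw [h.oddBelow_iff, h'.oddBelow_iff]
  refine (D0.induction (fun z => z ≤ y → (z ≤ x → (CodeMem c d z ↔ CodeMem a b z)) ∧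
    (x < z → (CodeMem c d z ↔ ¬ CodeMem a b z))) (fun _ => ⟨fun _ => iff_of_false h'.1 h.1,
      fun h => absurd h (not_lt.2 zero_le)⟩) (fun z ih hz => ?_) y le_rfl).2 hy
  have hz' := Num.add_one_le_iff.1 hz
  obtain ⟨ih1, ih2⟩ := ih hz'.le
  rw [h.2 z hz', h'.2 z hz', hXY z]
  refine ⟨fun hzx => ?_, fun hzx => ?_⟩
  · have := Num.add_one_le_iff.1 hzx
    rw [ih1 this.le, and_iff_left this.ne]
  · rcases (Num.lt_add_one_iff.1 hzx).eq_or_lt with rfl | hlt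
    · rw [ih1 le_rfl]
      simp [hx]
    · rw [ih2 hlt, and_iff_left hlt.ne']
      by_cases h1 : CodeMem a b z <;> by_cases h2 : z ∈ (X : Set M.Num) <;> simp [h1, h2]


/-! ## True intervals -/

variable {M : L2Structure.{u}} [hM : Fact M.ModelsRCA0] {Γ : Type u} [Ctx M Γ]

/-- The number `x'` is the successor of `x` in the set `X`. -/
def Next (X : M.sets) (x x' : M.Num) : Prop :=
  x ∈ (X : Set M.Num) ∧ x' ∈ (X : Set M.Num) ∧ x < x' ∧ ∀ z < x', x < z → z ∉ (X : Set M.Num)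

instance D0.next {f g : Γ → M.Num} {X : Γ → M.sets} [Tm f] [Tm g] [SV X] :
    D0 (fun γ => Next (X γ) (f γ) (g γ)) := by
  unfold Next
  infer_instance

/-- The number `n` has been enumerated into the domain of the relation coded by `Z` before
stage `s`. -/
def Stage (Z : M.sets) (s n : M.Num) : Prop := n < s ∧ ∃ a < s, pair n a ∈ (Z : Set M.Num)

instance D0.stage {f g : Γ → M.Num} {X : Γ → M.sets} [Tm f] [Tm g] [SV X] :
    D0 (fun γ => Stage (X γ) (f γ) (g γ)) := by
  unfold Stage
  infer_instance

/-- At some point between the stages `x` and `x'` a number is enumerated below which nothing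
is enumerated between the stages `x'` and `s`. -/
def TrueUpTo (Z : M.sets) (x x' s : M.Num) : Prop :=
  ∃ e < x', Stage Z x' e ∧ ¬ Stage Z x e ∧ ∀ n < e, Stage Z s n → Stage Z x' n

instance D0.trueUpTo {f g h : Γ → M.Num} {X : Γ → M.sets} [Tm f] [Tm g] [Tm h] [SV X] :
    D0 (fun γ => TrueUpTo (X γ) (f γ) (g γ) (h γ)) := by
  unfold TrueUpTo
  infer_instance

/-- Approximation with bound `t` to the statement that the interval of `X` that starts in `z` is
true. -/
def LabelUpTo (Z X : M.sets) (z t : M.Num) : Prop :=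
  ∀ z' < t, ∀ s < t, Next X z z' → TrueUpTo Z z z' s

instance D0.labelUpTo {f g : Γ → M.Num} {Z X : Γ → M.sets} [Tm f] [Tm g] [SV Z] [SV X] :
    D0 (fun γ => LabelUpTo (Z γ) (X γ) (f γ) (g γ)) := by
  unfold LabelUpTo
  infer_instance

/-- The interval of `X` that starts in `z` is true. -/
def Label (Z X : M.sets) (z : M.Num) : Prop := ∀ t, LabelUpTo Z X z t

/-- The set `X` is unbounded. -/
def Unbounded (X : M.sets) : Prop := ∀ m, ∃ n ∈ (X : Set M.Num), m < n

theorem Stage.mono {Z : M.sets} {s s' n : M.Num} (h : Stage Z s n) (hs : s ≤ s') :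
    Stage Z s' n :=
  ⟨h.1.trans_le hs, h.2.imp fun _ ha => ⟨ha.1.trans_le hs, ha.2⟩⟩

theorem exists_stage_iff {Z : M.sets} {n : M.Num} :
    (∃ s, Stage Z s n) ↔ ∃ a, pair n a ∈ (Z : Set M.Num) :=
  ⟨fun ⟨_, _, a, _, ha⟩ => ⟨a, ha⟩, fun ⟨a, ha⟩ => ⟨n + a + 1, Num.lt_add_one_iff.2 le_self_add,
    a, Num.lt_add_one_iff.2 le_add_self, ha⟩⟩

theorem LabelUpTo.anti {Z X : M.sets} {z t t' : M.Num} (h : LabelUpTo Z X z t) (ht : t' ≤ t) :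
    LabelUpTo Z X z t' :=
  fun z' hz' s hs => h z' (hz'.trans_le ht) s (hs.trans_le ht)

theorem label_of_forall_ge {Z X : M.sets} {z t : M.Num} (h : ∀ t' ≥ t, LabelUpTo Z X z t') :
    Label Z X z :=
  fun t' => (h (max t t') (le_max_left _ _)).anti (le_max_right _ _)

theorem Next.unique {X : M.sets} {x y z : M.Num} (h : Next X x y) (h' : Next X x z) : y = z := by
  rcases lt_trichotomy y z with hlt | he | hlt
  · exact absurd h.2.1 (h'.2.2.2 y hlt h.2.2.1)
  · exact he
  · exact absurd h'.2.1 (h.2.2.2 z hlt h'.2.2.1)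

theorem label_iff {Z X : M.sets} {z z' : M.Num} (h : Next X z z') :
    Label Z X z ↔ ∀ s, TrueUpTo Z z z' s := by
  refine ⟨fun hl s => hl (z' + s + 1) z' (Num.lt_add_one_iff.2 le_self_add) s
    (Num.lt_add_one_iff.2 le_add_self) h, fun hs t w _ s _ hw => ?_⟩
  rw [← h.unique hw]
  exact hs s

theorem Unbounded.exists_next {X : M.sets} (hX : Unbounded X) {x : M.Num}
    (hx : x ∈ (X : Set M.Num)) : ∃ x', Next X x x' := by
  obtain ⟨n, hn⟩ := hX x
  obtain ⟨x', ⟨h1, h2⟩, h3⟩ := D0.least (fun n => n ∈ (X : Set M.Num) ∧ x < n) ⟨n, hn⟩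
  exact ⟨x', hx, h1, h2, fun z hz hxz hzX => h3 z hz ⟨hzX, hxz⟩⟩

/-- If nothing entered after stage `k`, that stage would define the projection. Otherwise, let `n`
be the least number that enters after `k`; the interval of `X` in which it enters is true, with
witness `n`. -/
theorem Unbounded.exists_label {Z : M.sets}
    (hZ : ¬ ∃ Y : M.sets, ∀ n, n ∈ (Y : Set M.Num) ↔ ∃ a, pair n a ∈ (Z : Set M.Num))
    {X : M.sets} (hX : Unbounded X) (m : M.Num) : ∃ x ∈ (X : Set M.Num), m < x ∧ Label Z X x := by
  obtain ⟨k, hkX, hk⟩ := hX m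
  have hne : ∃ n s, Stage Z s n ∧ ¬ Stage Z k n := by
    by_contra! H
    obtain ⟨Y, hY⟩ := D0.comprehension (M := M) (fun n => Stage Z k n)
    exact hZ ⟨Y, fun n => (hY n).trans
      ⟨fun h => exists_stage_iff.1 ⟨k, h⟩, fun h => (exists_stage_iff.2 h).elim fun s hs => H n s hs⟩⟩
  obtain ⟨n, ⟨s, hs, hn⟩, hmin⟩ := sigma_least (fun n s => Stage Z s n ∧ ¬ Stage Z k n) hne
  obtain ⟨b, hbX, hb⟩ := hX s
  obtain ⟨x', ⟨hx'X, hx'⟩, hleast⟩ :=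
    D0.least (fun x => x ∈ (X : Set M.Num) ∧ Stage Z x n) ⟨b, hbX, hs.mono hb.le⟩
  have hkx' : k < x' := by
    by_contra! h
    exact hn (hx'.mono h)
  obtain ⟨x, hxx', hxX, hx⟩ := D0.greatest_lt (fun x => x ∈ (X : Set M.Num)) ⟨k, hkx', hkX⟩
  have hkx := hx k hkx' hkX
  have hnext : Next X x x' := ⟨hxX, hx'X, hxx', fun z hz hxz hzX => absurd hxz (not_lt.2 (hx z hz hzX))⟩
  refine ⟨x, hxX, hk.trans_le hkx, (label_iff hnext).2 fun t => ⟨n, hx'.1, hx',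
    fun h => hleast x hxx' ⟨hxX, h⟩, fun i hi hit => ?_⟩⟩
  by_contra! h
  exact hmin i hi t ⟨hit, fun h' => h (h'.mono hkx'.le)⟩

/-- The number `e` is the least one that is enumerated between the stages `x` and `x'`, which are
successive elements of `X`. -/
def LeastEntry (Z X : M.sets) (x x' e : M.Num) : Prop :=
  Next X x x' ∧ Stage Z x' e ∧ ¬ Stage Z x e ∧ ∀ n < e, Stage Z x' n → Stage Z x n

instance D0.leastEntry {f g h : Γ → M.Num} {Z X : Γ → M.sets} [Tm f] [Tm g] [Tm h] [SV Z] [SV X] :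
    D0 (fun γ => LeastEntry (Z γ) (X γ) (f γ) (g γ) (h γ)) := by
  unfold LeastEntry
  infer_instance

theorem exists_leastEntry {Z X : M.sets} {x x' : M.Num} (h : Next X x x') (hl : Label Z X x) :
    ∃ e, LeastEntry Z X x x' e := by
  obtain ⟨e, -, he⟩ := (label_iff h).1 hl 0
  obtain ⟨e, ⟨h1, h2⟩, h3⟩ :=
    D0.least (fun e => Stage Z x' e ∧ ¬ Stage Z x e) ⟨e, he.1, he.2.1⟩
  exact ⟨e, h, h1, h2, fun n hn hs => not_not.1 fun h' => h3 n hn ⟨hs, h'⟩⟩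

/-- The least entry is at most the entry that witnesses truth, so nothing below it enters after `x'`
either. -/
theorem LeastEntry.stage {Z X : M.sets} {x x' e n s : M.Num} (h : LeastEntry Z X x x' e)
    (hl : Label Z X x) (hn : n < e) (hs : Stage Z s n) : Stage Z x' n := by
  obtain ⟨e', -, h1, h2, h3⟩ := (label_iff h.1).1 hl s
  refine h3 n (hn.trans_le ?_) hs
  by_contra! h'
  exact h2 (h.2.2.2 e' h' h1)

/-- If all intervals beyond `m` were true, their least entries would increase strictly and hence be
unbounded. Whether `n` is in the projection could then be read off at the end of any such interval
with least entry above `n`, a `Δ⁰₁` condition. -/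
theorem Unbounded.exists_not_label {Z : M.sets}
    (hZ : ¬ ∃ Y : M.sets, ∀ n, n ∈ (Y : Set M.Num) ↔ ∃ a, pair n a ∈ (Z : Set M.Num))
    {X : M.sets} (hX : Unbounded X) (m : M.Num) :
    ∃ x ∈ (X : Set M.Num), m < x ∧ ¬ Label Z X x := by
  by_contra! H
  have key : ∀ n, ∃ w, ∃ x < w, ∃ x' < w, ∃ e < w, m < x ∧ LeastEntry Z X x x' e ∧ n ≤ e := by
    refine sigma_induction
      (fun n w => ∃ x < w, ∃ x' < w, ∃ e < w, m < x ∧ LeastEntry Z X x x' e ∧ n ≤ e) ?_ ?_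
    · obtain ⟨x, hxX, hx⟩ := hX m
      obtain ⟨x', hx'⟩ := hX.exists_next hxX
      obtain ⟨e, he⟩ := exists_leastEntry hx' (H x hxX hx)
      exact ⟨x + x' + e + 1, x, Num.lt_add_one_iff.2 (le_self_add.trans le_self_add), x',
        Num.lt_add_one_iff.2 (le_add_self.trans le_self_add), e, Num.lt_add_one_iff.2 le_add_self,
        hx, he, zero_le⟩
    · rintro n ⟨w, x, -, x', -, e, -, hx, he, hn⟩
      have hx' : m < x' := hx.trans he.1.2.2.1
      obtain ⟨y, hy⟩ := hX.exists_next he.1.2.1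
      obtain ⟨d, hd⟩ := exists_leastEntry hy (H x' he.1.2.1 hx')
      refine ⟨x' + y + d + 1, x', Num.lt_add_one_iff.2 (le_self_add.trans le_self_add), y,
        Num.lt_add_one_iff.2 (le_add_self.trans le_self_add), d, Num.lt_add_one_iff.2 le_add_self,
        hx', hd, Num.add_one_le_iff.2 (hn.trans_lt ?_)⟩
      -- At stage `x'` the number `e` is present, and so is every smaller number that ever enters;
      -- hence neither can be the new entry `d`.
      by_contra! h
      rcases h.eq_or_lt with rfl | h
      · exact hd.2.2.1 he.2.1
      · exact hd.2.2.1 (he.stage (H x he.1.1 hx) h hd.2.1)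
  obtain ⟨Y, hY⟩ := delta_comprehension (M := M) (fun n s => Stage Z s n)
    (fun n w => ∃ x < w, ∃ x' < w, ∃ e < w, m < x ∧ LeastEntry Z X x x' e ∧ n + 1 ≤ e ∧
      ¬ Stage Z x' n) fun n => by
    constructor
    · rintro ⟨s, hs⟩ ⟨w, x, -, x', -, e, -, hx, he, hn, hns⟩
      exact hns (he.stage (H x he.1.1 hx) (Num.add_one_le_iff.1 hn) hs)
    · intro h
      by_contra! hns
      obtain ⟨w, x, hxw, x', hx'w, e, hew, hx, he, hn⟩ := key (n + 1)
      exact h ⟨w, x, hxw, x', hx'w, e, hew, hx, he, hn, hns x'⟩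
  exact hZ ⟨Y, fun n => (hY n).trans exists_stage_iff⟩

/-! ## The bad function -/

/-- The element `y` of `X` is the first one with a label that differs from that of the minimal
element of `X`. -/
def Switch (Z X : M.sets) (y : M.Num) : Prop :=
  y ∈ (X : Set M.Num) ∧ (∃ x < y, x ∈ (X : Set M.Num)) ∧
    ∀ z < y, z ∈ (X : Set M.Num) → (Label Z X z ↔ ¬ Label Z X y)

/-- The value of the bad function at `X` is `q`. -/
def Color (Z X : M.sets) (q : M.Num) : Prop :=
  ∃ y, Switch Z X y ∧ ((¬ OddBelow X y ∧ q = 1) ∨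
    (OddBelow X y ∧ ((¬ Label Z X y ∧ q = 0) ∨ (Label Z X y ∧ q = 1 + 1))))

theorem Switch.unique {Z X : M.sets} {y y' : M.Num} (h : Switch Z X y) (h' : Switch Z X y') :
    y = y' := by
  wlog hlt : y < y' generalizing y y'
  · rcases lt_trichotomy y y' with h1 | h1 | h1
    exacts [absurd h1 hlt, h1, (this h' h h1).symm]
  obtain ⟨x, hxy, hx⟩ := h.2.1
  have h1 := h.2.2 x hxy hx
  have h2 := h'.2.2 x (hxy.trans hlt) hx
  have h3 := h'.2.2 y hlt h.1
  by_cases hl : Label Z X y <;> simp_all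

/-- This is `Σ⁰₁`-bounding; it works by taking maxima because a refuted label stays refuted for
larger bounds. -/
theorem exists_bound_of_not_label {Z X : M.sets} {y : M.Num}
    (h : ∀ z < y, z ∈ (X : Set M.Num) → ¬ Label Z X z) :
    ∃ u, ∀ z < y, z ∈ (X : Set M.Num) → ¬ LabelUpTo Z X z u := by
  obtain ⟨u, hu⟩ := sigma_induction
    (fun k u => k ≤ y → ∀ z < k, z ∈ (X : Set M.Num) → ¬ LabelUpTo Z X z u)
    ⟨0, fun _ z hz => absurd hz (not_lt.2 zero_le)⟩ (fun k ⟨u, hu⟩ => by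
      by_cases hk : k < y ∧ k ∈ (X : Set M.Num)
      · obtain ⟨t, ht⟩ := not_forall.1 (h k hk.1 hk.2)
        refine ⟨max u t, fun _ z hz hzX hl => ?_⟩
        rcases (Num.lt_add_one_iff.1 hz).eq_or_lt with rfl | hz'
        · exact ht (hl.anti (le_max_right _ _))
        · exact hu hk.1.le z hz' hzX (hl.anti (le_max_left _ _))
      · refine ⟨u, fun hky z hz hzX => ?_⟩
        have hky' := Num.add_one_le_iff.1 hky
        rcases (Num.lt_add_one_iff.1 hz).eq_or_lt with rfl | hz'
        · exact absurd ⟨hky', hzX⟩ hk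
        · exact hu hky'.le z hz' hzX) y
  exact ⟨u, hu le_rfl⟩

theorem Unbounded.exists_min {X : M.sets} (hX : Unbounded X) :
    ∃ x ∈ (X : Set M.Num), ∀ z < x, z ∉ (X : Set M.Num) :=
  D0.least (fun x => x ∈ (X : Set M.Num)) ((hX 0).imp fun _ h => h.1)

/-- Falsity is `Σ⁰₁`, so after a true minimum the least false element exists by `sigma_least`. After
a false minimum, absence of a switch would make all elements false by induction, where the common
bound `u` keeps the induction statement `Σ⁰₁`. -/
theorem Unbounded.exists_switch {Z : M.sets}
    (hZ : ¬ ∃ Y : M.sets, ∀ n, n ∈ (Y : Set M.Num) ↔ ∃ a, pair n a ∈ (Z : Set M.Num))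
    {X : M.sets} (hX : Unbounded X) : ∃ y, Switch Z X y := by
  obtain ⟨x, hxX, hx⟩ := hX.exists_min
  by_cases hl : Label Z X x
  · obtain ⟨y, hyX, -, hy⟩ := hX.exists_not_label hZ x
    obtain ⟨u, hu⟩ := not_forall.1 hy
    obtain ⟨y, ⟨u, hyX, hyu⟩, hmin⟩ := sigma_least
      (fun y u => y ∈ (X : Set M.Num) ∧ ¬ LabelUpTo Z X y u) ⟨y, u, hyX, hu⟩
    have hxy : x < y := by
      rcases lt_trichotomy x y with h | rfl | h
      exacts [h, absurd (hl u) hyu, absurd hyX (hx y h)]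
    refine ⟨y, hyX, ⟨x, hxy, hxX⟩, fun z hz hzX => iff_of_true
      (fun t => not_not.1 fun h => hmin z hz t ⟨hzX, h⟩) fun h => hyu (h u)⟩
  · by_contra! H
    obtain ⟨y, hyX, -, hy⟩ := hX.exists_label hZ 0
    obtain ⟨u, hu⟩ := sigma_induction
      (fun k u => ∀ z < k, z ∈ (X : Set M.Num) → ¬ LabelUpTo Z X z u)
      ⟨0, fun z hz => absurd hz (not_lt.2 zero_le)⟩ (fun k ⟨u, hu⟩ => by
        have hk : k ∈ (X : Set M.Num) → ¬ Label Z X k := fun hkX hlk => by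
          refine H k ⟨hkX, ⟨x, ?_, hxX⟩, fun z hz hzX => iff_of_false (fun h => hu z hz hzX (h u))
            (not_not.2 hlk)⟩
          rcases lt_trichotomy x k with h | rfl | h
          exacts [h, absurd hlk hl, absurd hkX (hx k h)]
        refine exists_bound_of_not_label fun z hz hzX => ?_
        rcases (Num.lt_add_one_iff.1 hz).eq_or_lt with rfl | hz'
        exacts [hk hzX, fun h => hu z hz' hzX (h u)]) (y + 1)
    exact hu y (Num.lt_add_one_iff.2 le_rfl) hyX (hy u)

theorem exists_color {Z X : M.sets} (h : ∃ y, Switch Z X y) : ∃ q ∈ M.three, Color Z X q := by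
  obtain ⟨y, hy⟩ := h
  by_cases ho : OddBelow X y
  · by_cases hl : Label Z X y
    · exact ⟨1 + 1, Or.inr (Or.inr rfl), y, hy, Or.inr ⟨ho, Or.inr ⟨hl, rfl⟩⟩⟩
    · exact ⟨0, Or.inl rfl, y, hy, Or.inr ⟨ho, Or.inl ⟨hl, rfl⟩⟩⟩
  · exact ⟨1, Or.inr (Or.inl rfl), y, hy, Or.inl ⟨ho, rfl⟩⟩

theorem Color.unique {Z X : M.sets} {q q' : M.Num} (h : Color Z X q) (h' : Color Z X q') :
    q = q' := by
  obtain ⟨y, hy, h⟩ := h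
  obtain ⟨y', hy', h'⟩ := h'
  obtain rfl := hy.unique hy'
  rcases h with ⟨h1, rfl⟩ | ⟨h1, ⟨h2, rfl⟩ | ⟨h2, rfl⟩⟩ <;>
  rcases h' with ⟨h3, rfl⟩ | ⟨h3, ⟨h4, rfl⟩ | ⟨h4, rfl⟩⟩ <;> first | rfl | contradiction

/-- The bounded part of a `Σ⁰₂` definition of `Color`. -/
def ColorMatrix (Z X : M.sets) (q y a b u t : M.Num) : Prop :=
  y ∈ (X : Set M.Num) ∧ (∃ x < y, x ∈ (X : Set M.Num)) ∧ ParityCode X y a b ∧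
    (((∀ z < y, z ∈ (X : Set M.Num) → LabelUpTo Z X z t) ∧ ¬ LabelUpTo Z X y u) ∧
      ((¬ CodeMem a b y ∧ q = 1) ∨ (CodeMem a b y ∧ q = 0)) ∨
    ((∀ z < y, z ∈ (X : Set M.Num) → ¬ LabelUpTo Z X z u) ∧ LabelUpTo Z X y t) ∧
      ((¬ CodeMem a b y ∧ q = 1) ∨ (CodeMem a b y ∧ q = 1 + 1)))

set_option synthInstance.maxSize 1000 in
instance D0.colorMatrix {f₁ f₂ f₃ f₄ f₅ f₆ : Γ → M.Num} {Z X : Γ → M.sets} [Tm f₁] [Tm f₂] [Tm f₃]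
    [Tm f₄] [Tm f₅] [Tm f₆] [SV Z] [SV X] :
    D0 (fun γ => ColorMatrix (Z γ) (X γ) (f₁ γ) (f₂ γ) (f₃ γ) (f₄ γ) (f₅ γ) (f₆ γ)) := by
  unfold ColorMatrix
  infer_instance

/-- The body of a `Σ⁰₂` definition of `Color`, with a single number for the existential
quantifier. -/
def ColorBody (Z X : M.sets) (q w t : M.Num) : Prop :=
  ∃ y < w + 1, ∃ a < w + 1, ∃ b < w + 1, ∃ u < w + 1, w = pair (pair y a) (pair b u) ∧
    ColorMatrix Z X q y a b u t

instance D0.colorBody {f g h : Γ → M.Num} {Z X : Γ → M.sets} [Tm f] [Tm g] [Tm h] [SV Z] [SV X] :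
    D0 (fun γ => ColorBody (Z γ) (X γ) (f γ) (g γ) (h γ)) := by
  unfold ColorBody
  infer_instance

/-- The disjunction may stand under `∀ t`: if `y` is true, its first alternative fails at `u`; if
`y` is false, its second fails for all large `t`. So the label of `y` selects the same alternative
for all large `t`. -/
theorem color_iff_matrix {Z X : M.sets} {q : M.Num} :
    Color Z X q ↔ ∃ y a b u, ∀ t, ColorMatrix Z X q y a b u t := by
  constructor
  · rintro ⟨y, ⟨hyX, hx, hy⟩, hq⟩
    obtain ⟨a, b, hab⟩ := exists_parityCode X y
    rw [hab.oddBelow_iff] at hq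
    by_cases hl : Label Z X y
    · obtain ⟨u, hu⟩ := exists_bound_of_not_label
        fun z hz hzX h => (hy z hz hzX).1 h hl
      exact ⟨y, a, b, u, fun t => ⟨hyX, hx, hab, Or.inr ⟨⟨hu, hl t⟩, by simpa [hl] using hq⟩⟩⟩
    · obtain ⟨u, hu⟩ := not_forall.1 hl
      exact ⟨y, a, b, u, fun t => ⟨hyX, hx, hab, Or.inl
        ⟨⟨fun z hz hzX => (hy z hz hzX).2 hl t, hu⟩, by simpa [hl] using hq⟩⟩⟩
  · rintro ⟨y, a, b, u, h⟩
    obtain ⟨hyX, hx, hab, -⟩ := h 0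
    refine ⟨y, ⟨hyX, hx, fun z hz hzX => ?_⟩, ?_⟩
    · by_cases hl : Label Z X y
      · refine iff_of_false (fun hz' => ?_) (not_not.2 hl)
        rcases (h 0).2.2.2 with h1 | h1
        exacts [h1.1.2 (hl u), h1.1.1 z hz hzX (hz' u)]
      · obtain ⟨t, ht⟩ := not_forall.1 hl
        refine iff_of_true (label_of_forall_ge (t := t) fun t' ht' => ?_) hl
        rcases (h t').2.2.2 with h1 | h1
        exacts [h1.1.1 z hz hzX, absurd (h1.1.2.anti ht') ht]
    · rw [hab.oddBelow_iff]
      by_cases hl : Label Z X y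
      · rcases (h 0).2.2.2 with h1 | h1
        · exact absurd (hl u) h1.1.2
        · simpa [hl] using h1.2
      · obtain ⟨t, ht⟩ := not_forall.1 hl
        rcases (h t).2.2.2 with h1 | h1
        · simpa [hl] using h1.2
        · exact absurd h1.1.2 ht

/-- Since pairing is injective, the components decoded from `w` do not vary with `t`. -/
theorem color_iff_body {Z X : M.sets} {q : M.Num} :
    Color Z X q ↔ ∃ w, ∀ t, ColorBody Z X q w t := by
  rw [color_iff_matrix]
  constructor
  · rintro ⟨y, a, b, u, h⟩
    refine ⟨pair (pair y a) (pair b u), fun t => ⟨y, Num.lt_add_one_iff.2 ?_, a,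
      Num.lt_add_one_iff.2 ?_, b, Num.lt_add_one_iff.2 ?_, u, Num.lt_add_one_iff.2 ?_, rfl, h t⟩⟩
    · exact (left_le_pair _ _).trans (left_le_pair _ _)
    · exact (right_le_pair _ _).trans (left_le_pair _ _)
    · exact (left_le_pair _ _).trans (right_le_pair _ _)
    · exact (right_le_pair _ _).trans (right_le_pair _ _)
  · rintro ⟨w, h⟩
    obtain ⟨y, -, a, -, b, -, u, -, rfl, -⟩ := h 0
    refine ⟨y, a, b, u, fun t => ?_⟩
    obtain ⟨y', -, a', -, b', -, u', -, he, ht⟩ := h t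
    obtain ⟨h1, h2⟩ := pair_inj he
    obtain ⟨rfl, rfl⟩ := pair_inj h1
    obtain ⟨rfl, rfl⟩ := pair_inj h2
    exact ht

/-- A label depends only on an element and its successor, and removing the minimum preserves
successors. -/
theorem label_erase_min {Z X Y : M.sets} {x z : M.Num} (hx : ∀ z < x, z ∉ (X : Set M.Num))
    (hXY : ∀ z, z ∈ (Y : Set M.Num) ↔ z ∈ (X : Set M.Num) ∧ z ≠ x) (hz : z ∈ (Y : Set M.Num)) :
    Label Z Y z ↔ Label Z X z := by
  have hxz : x < z := lt_of_not_ge fun h =>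
    (lt_or_eq_of_le h).elim (fun h => hx z h ((hXY z).1 hz).1) ((hXY z).1 hz).2
  have key : ∀ z', Next Y z z' ↔ Next X z z' := fun z' => by
    unfold Next
    simp only [hXY]
    refine ⟨fun ⟨h1, h2, h3, h4⟩ => ⟨h1.1, h2.1, h3, fun w hw hzw hwX =>
      h4 w hw hzw ⟨hwX, (hxz.trans hzw).ne'⟩⟩, fun ⟨h1, h2, h3, h4⟩ => ⟨⟨h1, hxz.ne'⟩,
        ⟨h2, (hxz.trans h3).ne'⟩, h3, fun w hw hzw hwX => h4 w hw hzw hwX.1⟩⟩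
  simp only [Label, LabelUpTo, key]

theorem Color.ne_of_erase_min {Z X Y : M.sets} {x p q : M.Num} (hY : Unbounded Y)
    (hxX : x ∈ (X : Set M.Num)) (hx : ∀ z < x, z ∉ (X : Set M.Num))
    (hXY : ∀ z, z ∈ (Y : Set M.Num) ↔ z ∈ (X : Set M.Num) ∧ z ≠ x)
    (hp : Color Z X p) (hq : Color Z Y q) : p ≠ q := by
  have h01 : (0 : M.Num) ≠ 1 := zero_ne_one
  have h12 : (1 : M.Num) ≠ 1 + 1 := (Num.lt_add_one_iff.2 le_rfl).ne
  have h02 : (0 : M.Num) ≠ 1 + 1 := (Num.succ_ne_zero 1).symm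
  obtain ⟨y, hy, hp⟩ := hp
  obtain ⟨y', hy', hq⟩ := hq
  obtain ⟨x₁, hx₁Y, hx₁⟩ := hY.exists_min
  have hlt : ∀ z ∈ (X : Set M.Num), z ≠ x → x < z := fun z hz hne => lt_of_not_ge fun h =>
    (lt_or_eq_of_le h).elim (fun h => hx z h hz) hne
  have hxy : x < y := by
    obtain ⟨w, hwy, hw⟩ := hy.2.1
    exact (not_lt.1 fun h => hx w h hw).trans_lt hwy
  have hyY : y ∈ (Y : Set M.Num) := (hXY y).2 ⟨hy.1, hxy.ne'⟩
  have hlab := fun z (hz : z ∈ (Y : Set M.Num)) => label_erase_min (Z := Z) hx hXY hz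
  have hodd := oddBelow_erase hxX hXY hxy
  -- Equality means that `y` is the second element of `X`, which is the case where the switching
  -- point moves.
  rcases (not_lt.1 fun h => hx₁ y h hyY : x₁ ≤ y).eq_or_lt with rfl | hx₁y
  · have hne : ¬ OddBelow Y x₁ := not_oddBelow_of_forall_notMem hx₁
    have hx₁y' : x₁ < y' := by
      obtain ⟨w, hwy, hw⟩ := hy'.2.1
      exact (not_lt.1 fun h => hx₁ w h hw).trans_lt hwy
    have h1 := (hlab x₁ hyY).symm.trans (hy'.2.2 x₁ hx₁y' hyY)
    have h2 : OddBelow X x₁ := not_not.1 fun h => hne (hodd.2 h)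
    rcases hp with ⟨h3, rfl⟩ | ⟨-, ⟨h3, rfl⟩ | ⟨h3, rfl⟩⟩
    · exact absurd h2 h3
    · rcases hq with ⟨-, rfl⟩ | ⟨-, ⟨h4, rfl⟩ | ⟨-, rfl⟩⟩
      exacts [h01, absurd (h1.2 h4) h3, h02]
    · rcases hq with ⟨-, rfl⟩ | ⟨-, ⟨-, rfl⟩ | ⟨h4, rfl⟩⟩
      exacts [h12.symm, h02.symm, absurd h4 (h1.1 h3)]
  · have hsw : Switch Z Y y := ⟨hyY, ⟨x₁, hx₁y, hx₁Y⟩, fun z hz hzY => by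
      rw [hlab z hzY, hlab y hyY]
      exact hy.2.2 z hz ((hXY z).1 hzY).1⟩
    obtain rfl := hsw.unique hy'
    rcases hp with ⟨h3, rfl⟩ | ⟨h3, ⟨-, rfl⟩ | ⟨-, rfl⟩⟩ <;>
    rcases hq with ⟨h4, rfl⟩ | ⟨h4, ⟨-, rfl⟩ | ⟨-, rfl⟩⟩
    exacts [absurd (hodd.2 h3) h4, h01.symm, h12, h01, absurd h3 (hodd.1 h4), absurd h3 (hodd.1 h4),
      h12.symm, absurd h3 (hodd.1 h4), absurd h3 (hodd.1 h4)]


variable {M : L2Structure.{u}}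

/-! ## From `Δ⁰₂`-`BQO` to the jump -/

theorem ThreeIsDelta2BQO.exists_domain [hM : Fact M.ModelsRCA0] (h : M.ThreeIsDelta2BQO)
    (Z : M.sets) :
    ∃ Y : M.sets, ∀ n, n ∈ (Y : Set M.Num) ↔ ∃ a, pair n a ∈ (Z : Set M.Num) := by
  by_contra hZ
  have hub : ∀ X : M.InfSet, Unbounded X.1 := fun X => X.2
  choose F hF3 hF using fun X : M.InfSet => exists_color ((hub X).exists_switch hZ)
  refine h ⟨F, ⟨hF3, ?_⟩, ?_⟩
  · obtain ⟨p, S, φ, hφ, hφC⟩ := (inferInstance :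
      D0 fun x : ((M.sets × M.Num) × M.Num) × M.Num => ColorBody Z x.1.1.1 x.1.1.2 x.1.2 x.2)
    -- The places `0`, `2`, `4` hold `q`, `w`, `t`. The entry `Z` at set place `0` is a filler that
    -- `X` overwrites.
    refine ⟨.ex 2 (.all 4 φ), ⟨2, _, ⟨4, φ, hφ, rfl⟩, rfl⟩, 0, 0, fun i => p (i / 2),
      fun i => Nat.casesOn i Z S, fun X q => ?_⟩
    have h1 : F X = q ↔ Color Z X.1 q := ⟨fun e => e ▸ hF X, fun hq => (hF X).unique hq⟩
    rw [h1, color_iff_body]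
    refine exists_congr fun w => forall_congr' fun t => ?_
    refine (hφC (((X.1, q), w), t) _ _ ((((numFits_params X.1 p).update q).update w).update t)
      ⟨?_, fun i => ?_⟩).symm
    · exact Function.update_self _ _ _
    · exact Function.update_of_ne (Nat.succ_ne_zero i) _ _
  · rintro ⟨X, Y, hY, hXY⟩
    obtain ⟨x, hxX, hx⟩ := (hub X).exists_min
    refine (hF X).ne_of_erase_min (hub Y) hxX hx (fun z => ?_) (hF Y) hXY
    rw [hY]
    refine and_congr_right fun hz => not_congr ⟨fun hm => ?_, ?_⟩
    · rcases lt_trichotomy z x with h | h | h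
      exacts [absurd hz (hx z h), h, absurd h (hm.2 x hxX)]
    · rintro rfl
      exact ⟨hz, fun b hb hlt => hx b hlt hb⟩

/-! ## Arithmetical comprehension from the jump -/

theorem eval_congr (t : NumTerm) :
    ∃ N, ∀ v w : ℕ → M.Num, (∀ i < N, v i = w i) → M.eval v t = M.eval w t := by
  induction t with
  | var i => exact ⟨i + 1, fun v w h => h i (Nat.lt_succ_self i)⟩
  | zero => exact ⟨0, fun _ _ _ => rfl⟩
  | one => exact ⟨0, fun _ _ _ => rfl⟩
  | add s t hs ht =>
    obtain ⟨m, hm⟩ := hs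
    obtain ⟨n, hn⟩ := ht
    exact ⟨max m n, fun v w h => congrArg₂ M.add
      (hm v w fun i hi => h i (lt_max_of_lt_left hi)) (hn v w fun i hi => h i (lt_max_of_lt_right hi))⟩
  | mul s t hs ht =>
    obtain ⟨m, hm⟩ := hs
    obtain ⟨n, hn⟩ := ht
    exact ⟨max m n, fun v w h => congrArg₂ M.mul
      (hm v w fun i hi => h i (lt_max_of_lt_left hi)) (hn v w fun i hi => h i (lt_max_of_lt_right hi))⟩

/-- The truth of `φ` depends only on the values of the number variables below `N`. -/
def SupportedBelow (M : L2Structure.{u}) (N : ℕ) (φ : Formula) : Prop :=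
  ∀ (v w : ℕ → M.Num) (V : ℕ → M.sets), (∀ i < N, v i = w i) → (M.Sat φ v V ↔ M.Sat φ w V)

theorem SupportedBelow.mono {m n : ℕ} {φ : Formula} (h : M.SupportedBelow m φ) (hmn : m ≤ n) :
    M.SupportedBelow n φ := fun v w V hvw => h v w V fun i hi => hvw i (hi.trans_le hmn)

theorem update_congr {α : Type*} {N : ℕ} {v w : ℕ → α} (h : ∀ i < N, v i = w i) (k : ℕ) (a : α) :
    ∀ i < N, Function.update v k a i = Function.update w k a i := by
  intro i hi
  rcases eq_or_ne i k with rfl | hik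
  · simp
  · rw [Function.update_of_ne hik, Function.update_of_ne hik, h i hi]

/-- This supplies variables that the formula ignores, and a finite tuple of values that determines
its truth. -/
theorem exists_supportedBelow (M : L2Structure.{u}) (φ : Formula) : ∃ N, M.SupportedBelow N φ := by
  induction φ with
  | eq s t =>
    obtain ⟨m, hm⟩ := eval_congr (M := M) s
    obtain ⟨n, hn⟩ := eval_congr (M := M) t
    refine ⟨max m n, fun v w V h => ?_⟩
    rw [Sat, Sat, hm v w fun i hi => h i (lt_max_of_lt_left hi),
      hn v w fun i hi => h i (lt_max_of_lt_right hi)]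
  | lt s t =>
    obtain ⟨m, hm⟩ := eval_congr (M := M) s
    obtain ⟨n, hn⟩ := eval_congr (M := M) t
    refine ⟨max m n, fun v w V h => ?_⟩
    rw [Sat, Sat, hm v w fun i hi => h i (lt_max_of_lt_left hi),
      hn v w fun i hi => h i (lt_max_of_lt_right hi)]
  | mem t j =>
    obtain ⟨n, hn⟩ := eval_congr (M := M) t
    exact ⟨n, fun v w V h => by rw [Sat, Sat, hn v w h]⟩
  | neg φ h =>
    obtain ⟨n, hn⟩ := h
    exact ⟨n, fun v w V h => not_congr (hn v w V h)⟩
  | and φ ψ h h' =>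
    obtain ⟨m, hm⟩ := h
    obtain ⟨n, hn⟩ := h'
    exact ⟨max m n, fun v w V h => and_congr (hm.mono (le_max_left _ _) v w V h)
      (hn.mono (le_max_right _ _) v w V h)⟩
  | or φ ψ h h' =>
    obtain ⟨m, hm⟩ := h
    obtain ⟨n, hn⟩ := h'
    exact ⟨max m n, fun v w V h => or_congr (hm.mono (le_max_left _ _) v w V h)
      (hn.mono (le_max_right _ _) v w V h)⟩
  | imp φ ψ h h' =>
    obtain ⟨m, hm⟩ := h
    obtain ⟨n, hn⟩ := h'
    exact ⟨max m n, fun v w V h => imp_congr (hm.mono (le_max_left _ _) v w V h)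
      (hn.mono (le_max_right _ _) v w V h)⟩
  | all k φ h =>
    obtain ⟨n, hn⟩ := h
    exact ⟨n, fun v w V h => forall_congr' fun a => hn _ _ V (update_congr h k a)⟩
  | ex k φ h =>
    obtain ⟨n, hn⟩ := h
    exact ⟨n, fun v w V h => exists_congr fun a => hn _ _ V (update_congr h k a)⟩
  | allSet j φ h =>
    obtain ⟨n, hn⟩ := h
    exact ⟨n, fun v w V h => forall_congr' fun X => hn v w _ h⟩
  | exSet j φ h =>
    obtain ⟨n, hn⟩ := h
    exact ⟨n, fun v w V h => exists_congr fun X => hn v w _ h⟩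

/-- A dummy quantifier over a variable that `φ` ignores presents it both as `Σ⁰₁` and as `Π⁰₁`. -/
theorem bounded_comprehension (hM : M.ModelsRCA0) {φ : Formula} (hφ : φ.IsBounded) (i : ℕ)
    (v : ℕ → M.Num) (V : ℕ → M.sets) :
    ∃ X : M.sets, ∀ n, n ∈ (X : Set M.Num) ↔ M.Sat φ (Function.update v i n) V := by
  obtain ⟨N, hN⟩ := exists_supportedBelow M φ
  have key : ∀ n a, M.Sat φ (Function.update (Function.update v i n) N a) V ↔
      M.Sat φ (Function.update v i n) V := fun n a =>
    hN _ _ V fun j hj => Function.update_of_ne hj.ne _ _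
  obtain ⟨X, hX, h⟩ := hM.comprehension (.ex N φ) (.all N φ) ⟨N, φ, hφ, rfl⟩ ⟨N, φ, hφ, rfl⟩ i v V
    fun n => ⟨fun ⟨a, ha⟩ b => (key n b).2 ((key n a).1 ha), fun h => ⟨M.zero, h M.zero⟩⟩
  exact ⟨⟨X, hX⟩, fun n => (h n).trans
    ⟨fun ⟨a, ha⟩ => (key n a).1 ha, fun h => ⟨M.zero, (key n _).2 h⟩⟩⟩

/-- The term for the pairing function. -/
def pairTerm (s t : NumTerm) : NumTerm := .add (.mul (.add s t) (.add s t)) s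

/-- The code of the values of the first `k` variables. -/
def tupleTerm : ℕ → NumTerm
  | 0 => .zero
  | k + 1 => pairTerm (tupleTerm k) (.var k)

theorem eval_pairTerm (v : ℕ → M.Num) (s t : NumTerm) :
    M.eval v (pairTerm s t) = pair (M.eval v s) (M.eval v t) := rfl

theorem tupleTerm_inj [Fact M.ModelsRCA0] {v w : ℕ → M.Num} {k : ℕ}
    (h : M.eval v (tupleTerm k) = M.eval w (tupleTerm k)) : ∀ i < k, v i = w i := by
  induction k with
  | zero => intro i hi; omega
  | succ k ih =>
    obtain ⟨h1, h2⟩ := pair_inj h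
    intro i hi
    rcases Nat.lt_succ_iff_lt_or_eq.1 hi with hi | rfl
    exacts [ih h1 i hi, h2]

theorem eval_tupleTerm_congr {v w : ℕ → M.Num} {k : ℕ} (h : ∀ i < k, v i = w i) :
    M.eval v (tupleTerm k) = M.eval w (tupleTerm k) := by
  induction k with
  | zero => rfl
  | succ k ih =>
    rw [tupleTerm, eval_pairTerm, eval_pairTerm, ih fun i hi => h i (by omega), eval, eval,
      h k (by omega)]

theorem le_tupleTerm [Fact M.ModelsRCA0] (v : ℕ → M.Num) {k : ℕ} :
    ∀ i < k, v i ≤ M.eval v (tupleTerm k) := by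
  induction k with
  | zero => intro i hi; omega
  | succ k ih =>
    intro i hi
    rcases Nat.lt_succ_iff_lt_or_eq.1 hi with hi | rfl
    exacts [(ih i hi).trans (left_le_pair _ _), right_le_pair _ _]

/-- Bounded existential quantification over the first `k` variables, with the value of the variable
`N` as an inclusive bound. -/
def bexBlock (N : ℕ) : ℕ → Formula → Formula
  | 0, φ => φ
  | k + 1, φ => bexBlock N k (.ex k (.and (.lt (.var k) (.add (.var N) .one)) φ))

theorem isBounded_bexBlock {N k : ℕ} (hk : k ≤ N) {φ : Formula} (hφ : φ.IsBounded) :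
    (bexBlock N k φ).IsBounded := by
  induction k generalizing φ with
  | zero => exact hφ
  | succ k ih =>
    refine ih (by omega) (.bex ?_ hφ)
    simp only [NumTerm.vars, Set.union_empty, Set.mem_singleton_iff]
    omega

theorem sat_bexBlock {N k : ℕ} (hk : k ≤ N) {φ : Formula} {v : ℕ → M.Num} {V : ℕ → M.sets} :
    M.Sat (bexBlock N k φ) v V ↔
      ∃ w, (∀ j ≥ k, w j = v j) ∧ (∀ j < k, w j < v N + 1) ∧ M.Sat φ w V := by
  induction k generalizing φ with
  | zero =>
    refine ⟨fun h => ⟨v, fun _ _ => rfl, fun j hj => absurd hj (Nat.not_lt_zero j), h⟩, fun ⟨w, h1, _, h2⟩ => ?_⟩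
    rwa [show w = v from funext fun j => h1 j (Nat.zero_le j)] at h2
  | succ k ih =>
    rw [bexBlock, ih (by omega)]
    constructor
    · rintro ⟨w, h1, h2, a, h3, h4⟩
      have h3 : a < w N + 1 := by
        simp only [Sat, eval, Function.update_self, Function.update_of_ne (show N ≠ k by omega)] at h3
        exact h3
      refine ⟨Function.update w k a, fun j hj => ?_, fun j hj => ?_, h4⟩
      · rw [Function.update_of_ne (by omega), h1 j (by omega)]
      · rcases eq_or_ne j k with rfl | hjk
        · rwa [Function.update_self, ← h1 N (by omega)]
        · rw [Function.update_of_ne hjk]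
          exact h2 j (by omega)
    · rintro ⟨w, h1, h2, h3⟩
      refine ⟨Function.update w k (v k), fun j hj => ?_, fun j hj => ?_, w k, ?_, ?_⟩
      · rcases eq_or_ne j k with rfl | hjk
        · rw [Function.update_self]
        · rw [Function.update_of_ne hjk, h1 j (by omega)]
      · rw [Function.update_of_ne (by omega)]
        exact h2 j (by omega)
      · rw [Function.update_idem, Function.update_eq_self]
        have := h2 k (by omega)
        rw [← h1 N (by omega)] at this
        exact this
      · rwa [Function.update_idem, Function.update_eq_self]

/-- The pairs of a tuple code and a suitable value for variable `i` form a set `Z`: a code bounds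
its components, so decoding is bounded. Then `hJ` projects the value away. -/
theorem sigma1_eq_mem [hM : Fact M.ModelsRCA0]
    (hJ : ∀ Z : M.sets, ∃ Y : M.sets, ∀ n, n ∈ (Y : Set M.Num) ↔ ∃ a, pair n a ∈ (Z : Set M.Num))
    {θ : Formula} (hθ : θ.IsBounded) (i : ℕ) (V : ℕ → M.sets) :
    ∃ (N : ℕ) (Y : M.sets), ∀ v,
      M.Sat (.ex i θ) v V ↔ M.eval v (tupleTerm N) ∈ (Y : Set M.Num) := by
  obtain ⟨N, hN, hiN⟩ : ∃ N, M.SupportedBelow N θ ∧ i < N := by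
    obtain ⟨N, hN⟩ := exists_supportedBelow M θ
    exact ⟨max N (i + 1), hN.mono (le_max_left _ _), lt_max_of_lt_right (Nat.lt_succ_self i)⟩
  -- Binding variable `i` afresh and equating it with variable `N + 1` plays the role of a
  -- substitution into `θ`.
  let body : Formula := .and (.eq (.var N) (pairTerm (tupleTerm N) (.var (N + 1))))
    (.ex i (.and (.lt (.var i) (.add (.var N) .one)) (.and (.eq (.var i) (.var (N + 1))) θ)))
  have hbody : body.IsBounded := by
    refine .and (.eq _ _) (.bex ?_ (.and (.eq _ _) hθ))
    simp only [NumTerm.vars, Set.union_empty, Set.mem_singleton_iff]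
    omega
  let φ : Formula := .ex (N + 1) (.and (.lt (.var (N + 1)) (.add (.var N) .one)) (bexBlock N N body))
  have hφ : φ.IsBounded := by
    refine .bex ?_ (isBounded_bexBlock le_rfl hbody)
    simp only [NumTerm.vars, Set.union_empty, Set.mem_singleton_iff]
    omega
  have sat_body : ∀ w, M.Sat body w V ↔ w N = pair (M.eval w (tupleTerm N)) (w (N + 1)) ∧
      M.Sat θ (Function.update w i (w (N + 1))) V := by
    intro w
    refine and_congr_right fun (hw : w N = pair (M.eval w (tupleTerm N)) (w (N + 1))) => ?_
    simp only [Sat, eval, Function.update_self, Function.update_of_ne (show N ≠ i by omega),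
      Function.update_of_ne (show N + 1 ≠ i by omega)]
    constructor
    · rintro ⟨a, -, rfl, h⟩
      exact h
    · refine fun h => ⟨_, ?_, rfl, h⟩
      rw [hw]
      exact Num.lt_add_one_iff.2 (right_le_pair _ _)
  obtain ⟨Z, hZ⟩ := bounded_comprehension hM.out hφ N (fun _ => 0) V
  obtain ⟨Y, hY⟩ := hJ Z
  have key : ∀ v a, pair (M.eval v (tupleTerm N)) a ∈ (Z : Set M.Num) ↔
      M.Sat θ (Function.update v i a) V := by
    intro v a
    rw [hZ]
    constructor
    · rintro ⟨b, -, h⟩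
      obtain ⟨w, h1, -, h2⟩ := (sat_bexBlock le_rfl).1 h
      obtain ⟨h3, h4⟩ := (sat_body w).1 h2
      rw [h1 N le_rfl, h1 (N + 1) (by omega), Function.update_of_ne (by omega),
        Function.update_self, Function.update_self] at h3
      rw [h1 (N + 1) (by omega), Function.update_self] at h4
      obtain ⟨h5, rfl⟩ := pair_inj h3
      exact (hN _ _ V (update_congr (tupleTerm_inj h5) i a)).2 h4
    · intro h
      let w : ℕ → M.Num := fun j => if j < N then v j else
        Function.update (Function.update (fun _ => (0 : M.Num)) N (pair (M.eval v (tupleTerm N)) a)) (N + 1) a j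
      have hw : ∀ j < N, w j = v j := fun j hj => if_pos hj
      have hwN : w N = pair (M.eval v (tupleTerm N)) a := by simp [w]
      have hwN1 : w (N + 1) = a := by simp [w]
      refine ⟨a, ?_, (sat_bexBlock le_rfl).2 ⟨w, fun j hj => if_neg (by omega), fun j hj => ?_,
        (sat_body w).2 ⟨?_, ?_⟩⟩⟩
      · simp only [Sat, eval, Function.update_self, Function.update_of_ne (show N ≠ N + 1 by omega)]
        exact Num.lt_add_one_iff.2 (right_le_pair _ _)
      · rw [hw j hj, Function.update_of_ne (by omega), Function.update_self]
        exact Num.lt_add_one_iff.2 ((le_tupleTerm v j hj).trans (left_le_pair _ _))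
      · rw [hwN, hwN1, eval_tupleTerm_congr hw]
      · rw [hwN1]
        exact (hN _ _ V (update_congr hw i a)).2 h
  exact ⟨N, Y, fun v => ((hY _).trans (exists_congr fun a => key v a)).symm⟩

/-- With parameters `V`, the formula `φ` is equivalent to a bounded formula with other set
parameters. -/
def ReducesToBounded (M : L2Structure.{u}) (φ : Formula) (V : ℕ → M.sets) : Prop :=
  ∃ θ : Formula, θ.IsBounded ∧ ∃ V' : ℕ → M.sets, ∀ v, M.Sat φ v V ↔ M.Sat θ v V'

/-- The two families of set parameters are placed at even and odd indices. -/
theorem ReducesToBounded.common {φ ψ : Formula} {V : ℕ → M.sets}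
    (hφ : M.ReducesToBounded φ V) (hψ : M.ReducesToBounded ψ V) :
    ∃ θ η : Formula, θ.IsBounded ∧ η.IsBounded ∧ ∃ V' : ℕ → M.sets,
      ∀ v, (M.Sat φ v V ↔ M.Sat θ v V') ∧ (M.Sat ψ v V ↔ M.Sat η v V') := by
  obtain ⟨θ, hθ, S, hS⟩ := hφ
  obtain ⟨η, hη, T, hT⟩ := hψ
  have inj1 : (fun i : ℕ => 2 * i).Injective := fun i j h => by simp only at h; omega
  have inj2 : (fun i : ℕ => 2 * i + 1).Injective := fun i j h => by simp only at h; omega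
  refine ⟨θ.rename id fun i => 2 * i, η.rename id fun i => 2 * i + 1,
    hθ.rename Function.injective_id, hη.rename Function.injective_id, interleave S T, fun v => ?_⟩
  rw [sat_rename Function.injective_id inj1, sat_rename Function.injective_id inj2, hS, hT]
  have h1 : (interleave S T ∘ fun i : ℕ => 2 * i) = S := by
    funext i; simp [interleave]
  have h2 : (interleave S T ∘ fun i : ℕ => 2 * i + 1) = T := by
    funext i
    simp only [interleave, Function.comp]
    rw [if_neg (by omega), show (2 * i + 1) / 2 = i by omega]
  rw [h1, h2]
  exact ⟨Iff.rfl, Iff.rfl⟩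

/-- The new set parameters work for all number assignments at once, which lets the induction pass
under quantifiers. -/
theorem reducesToBounded [Fact M.ModelsRCA0]
    (hJ : ∀ Z : M.sets, ∃ Y : M.sets, ∀ n, n ∈ (Y : Set M.Num) ↔ ∃ a, pair n a ∈ (Z : Set M.Num))
    (φ : Formula) (hφ : φ.IsArithmetical) (V : ℕ → M.sets) : M.ReducesToBounded φ V := by
  induction φ with
  | eq s t => exact ⟨_, .eq s t, V, fun _ => Iff.rfl⟩
  | lt s t => exact ⟨_, .lt s t, V, fun _ => Iff.rfl⟩
  | mem t j => exact ⟨_, .mem t j, V, fun _ => Iff.rfl⟩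
  | neg φ ih =>
    obtain ⟨θ, hθ, V', h⟩ := ih hφ
    exact ⟨_, .neg hθ, V', fun v => not_congr (h v)⟩
  | and φ ψ ih ih' =>
    obtain ⟨θ, η, hθ, hη, V', h⟩ := (ih hφ.1).common (ih' hφ.2)
    exact ⟨_, .and hθ hη, V', fun v => and_congr (h v).1 (h v).2⟩
  | or φ ψ ih ih' =>
    obtain ⟨θ, η, hθ, hη, V', h⟩ := (ih hφ.1).common (ih' hφ.2)
    exact ⟨_, .or hθ hη, V', fun v => or_congr (h v).1 (h v).2⟩
  | imp φ ψ ih ih' =>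
    obtain ⟨θ, η, hθ, hη, V', h⟩ := (ih hφ.1).common (ih' hφ.2)
    exact ⟨_, .imp hθ hη, V', fun v => imp_congr (h v).1 (h v).2⟩
  | all i φ ih =>
    obtain ⟨θ, hθ, V', h⟩ := ih hφ
    obtain ⟨N, Y, hY⟩ := sigma1_eq_mem hJ (.neg hθ) i V'
    refine ⟨_, .neg (.mem (tupleTerm N) 0), fun _ => Y, fun v => ?_⟩
    refine Iff.trans ?_ (not_congr (hY v))
    simp only [Sat, h, not_exists, not_not]
  | ex i φ ih =>
    obtain ⟨θ, hθ, V', h⟩ := ih hφ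
    obtain ⟨N, Y, hY⟩ := sigma1_eq_mem hJ hθ i V'
    exact ⟨_, .mem (tupleTerm N) 0, fun _ => Y, fun v => (exists_congr fun a => h _).trans (hY v)⟩
  | allSet j φ ih => exact hφ.elim
  | exSet j φ ih => exact hφ.elim

end L2Structure

theorem mainTheorem10 (M : L2Structure.{u}) (hRCA : M.ModelsRCA0)
    (hthree : M.ThreeIsDelta2BQO) : M.ArithmeticalComprehension := by
  intro φ hφ i v V
  have : Fact M.ModelsRCA0 := ⟨hRCA⟩
  obtain ⟨θ, hθ, V', h⟩ := L2Structure.reducesToBounded hthree.exists_domain φ hφ V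
  obtain ⟨X, hX⟩ := L2Structure.bounded_comprehension hRCA hθ i v V'
  exact ⟨X.1, X.2, fun n => (hX n).trans (h _).symm⟩
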